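/- **Theorem 3.** All functions are real-valued. For $1\le s\le\infty$ let $L_s$ be the space of $2\pi$-periodic functions with the norm $\|f\|_s=\bigl(\int_0^{2\pi}|f(t)|^s\,dt\bigr)^{1/s}$ for $s<\infty$ and $\|f\|_\infty=\operatorname{ess\,sup}_t|f(t)|$. Let $B$ be the set of positive nonincreasing functions $\psi$ on $[1,\infty)$ for which there is $K>0$ with $\psi(t)/\psi(2t)\le K$ for all $t\ge1$. For $1\le q<\infty$ let $\Theta_q$ be the set of nonincreasing functions $\psi$ on $[1,\infty)$ for which there are $\alpha>1/q$ and $K>0$ with $t_1^{\alpha}\psi(t_1)\le K\,t_2^{\alpha}\psi(t_2)$ for all $t_1>t_2\ge1$. For $\beta\in\mathbb R$ let $L^{\psi}_{\beta,1}$ be the class of $2\pi$-periodic functions $f$ that for almost all $x\in\mathbb R$ can be written as $$f(x)=\frac{a_0}{2}+\frac1\pi\int_{-\pi}^{\pi}\Psi_\beta(x-t)\varphi(t)\,dt,\qquad a_0\in\mathbb R,\quad \varphi\in L_1,\quad \|\varphi\|_1\le1,\quad \int_{-\pi}^{\pi}\varphi(t)\,dt=0,$$ where $\Psi_\beta\in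 L_1$ is the function with Fourier series $\sum_{k=1}^{\infty}\psi(k)\cos\bigl(kt-\tfrac{\beta\pi}{2}\bigr)$. For $1<p\le\infty$ and $n\in\mathbb N=\{1,2,\dots\}$ put $$\mathcal E_n(L^{\psi}_{\beta,1})_p=\sup_{f\in L^{\psi}_{\beta,1}}\|f-S_{n-1}(f)\|_p,\qquad E_n(L^{\psi}_{\beta,1})_p=\sup_{f\in L^{\psi}_{\beta,1}}\ \inf_{t_{n-1}\in\mathcal T_{2n-1}}\|f-t_{n-1}\|_p,$$ where $S_{n-1}(f)$ is the Fourier sum of $f$ of order $n-1$ and $\mathcal T_{2n-1}$ is the space of trigonometric polynomials of order at most $n-1$. Let $1<p\le\infty$, $\frac1p+\frac1{p'}=1$, let $\psi\in B\cap\Theta_{p'}$ be continuous on $[1,\infty)$, and suppose that, with $\Delta^2(1/\psi(k))=\frac1{\psi(k)}-\frac2{\psi(k+1)}+\frac1{\psi(k+2)}$, either $\Delta^2(1/\psi(k))\ge0$ for all $k\in\mathbb N$ or $\Delta^2(1/\psi(k))\le0$ for all $k\in\mathbb N$. Then there are positive numbers $K^{(3)}_{\psi,p}$ and $K^{(4)}_{\psi,p}$,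 depending only on $\psi$ and $p$, such that for all $\beta\in\mathbb R$ and all $n\in\mathbb N$ $$K^{(4)}_{\psi,p}\,\psi(n)\,n^{1/p'}\le E_n(L^{\psi}_{\beta,1})_p\le\mathcal E_n(L^{\psi}_{\beta,1})_p\le K^{(3)}_{\psi,p}\,\psi(n)\,n^{1/p'}.$$ -/

import Mathlib

open MeasureTheory Set
open scoped Real ENNReal

noncomputable section

/-- Lebesgue measure `dt` on one period `(0, 2π]` (not normalized). -/
def periodMeasure : Measure ℝ := volume.restrict (Ioc 0 (2 * π))

/-- The norm of a `2π`-periodic function in `L_p`, `1 ≤ p ≤ ∞`, with values in `[0, ∞]`: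
`(∫_0^{2π} |f|^p dt)^{1/p}` for finite `p`, the essential supremum for `p = ∞`. -/
def perNorm (p : ℝ≥0∞) (f : ℝ → ℝ) : ℝ≥0∞ := eLpNorm f p periodMeasure

/-- `f` belongs to the space `L_p` of real `2π`-periodic functions. -/
def MemPerLp (p : ℝ≥0∞) (f : ℝ → ℝ) : Prop :=
  Function.Periodic f (2 * π) ∧ MemLp f p periodMeasure

/-- The Fourier coefficient `a_k(f) = (1/π) ∫_{-π}^{π} f(t) cos(kt) dt`. -/
def cosCoeff (f : ℝ → ℝ) (k : ℕ) : ℝ := (1 / π) * ∫ t in (-π)..π, f t * Real.cos (k * t)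

/-- The Fourier coefficient `b_k(f) = (1/π) ∫_{-π}^{π} f(t) sin(kt) dt`. -/
def sinCoeff (f : ℝ → ℝ) (k : ℕ) : ℝ := (1 / π) * ∫ t in (-π)..π, f t * Real.sin (k * t)

/-- The Fourier sum of order `m`:
`S_m(f; x) = a_0/2 + ∑_{k=1}^{m} (a_k cos kx + b_k sin kx)`. -/
def fourierSum (m : ℕ) (f : ℝ → ℝ) (x : ℝ) : ℝ :=
  cosCoeff f 0 / 2 +
    ∑ k ∈ Finset.Icc 1 m, (cosCoeff f k * Real.cos (k * x) + sinCoeff f k * Real.sin (k * x))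

/-- The real trigonometric polynomials of order at most `m`. -/
def trigPolys (m : ℕ) : Set (ℝ → ℝ) :=
  {t | ∃ (c : ℝ) (a b : ℕ → ℝ), ∀ x : ℝ,
    t x = c + ∑ k ∈ Finset.Icc 1 m, (a k * Real.cos (k * x) + b k * Real.sin (k * x))}

/-- `Ψ` is a summable `2π`-periodic function whose Fourier series is
`∑_{k ≥ 1} ψ(k) cos(kt - βπ/2)
  = ∑_{k ≥ 1} (ψ(k) cos(βπ/2) cos(kt) + ψ(k) sin(βπ/2) sin(kt))`. -/
def IsKernel (ψ : ℝ → ℝ) (β : ℝ) (Ψ : ℝ → ℝ) : Prop :=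
  MemPerLp 1 Ψ ∧ cosCoeff Ψ 0 = 0 ∧
    ∀ k : ℕ, 1 ≤ k →
      cosCoeff Ψ k = ψ k * Real.cos (β * π / 2) ∧ sinCoeff Ψ k = ψ k * Real.sin (β * π / 2)

/-- The class `L^ψ_{β,s}`: the `2π`-periodic functions `f` that are, for almost all `x`, of the form
`f(x) = a_0/2 + (1/π) ∫_{-π}^{π} Ψ_β(x - t) φ(t) dt` with `a_0 ∈ ℝ`, `‖φ‖_s ≤ 1` and `φ ⊥ 1`.
The kernel `Ψ_β` is determined by `ψ` and `β` up to a null set. -/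
def psiClass (ψ : ℝ → ℝ) (β : ℝ) (s : ℝ≥0∞) : Set (ℝ → ℝ) :=
  {f | Function.Periodic f (2 * π) ∧
    ∃ (Ψ : ℝ → ℝ) (a₀ : ℝ) (φ : ℝ → ℝ), IsKernel ψ β Ψ ∧
      MemPerLp s φ ∧ perNorm s φ ≤ 1 ∧ (∫ t in (-π)..π, φ t) = 0 ∧
      ∀ᵐ x : ℝ, f x = a₀ / 2 + (1 / π) * ∫ t in (-π)..π, Ψ (x - t) * φ t}

/-- The deviation of the Fourier sums of order `n - 1` on the class `N` in the metric of `L_p`. -/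
def fourierDeviation (n : ℕ) (N : Set (ℝ → ℝ)) (p : ℝ≥0∞) : ℝ≥0∞ :=
  ⨆ f ∈ N, perNorm p (fun x => f x - fourierSum (n - 1) f x)

/-- The best approximation of the class `N` by trigonometric polynomials of order at most `n - 1`
in the metric of `L_p`. -/
def bestApprox (n : ℕ) (N : Set (ℝ → ℝ)) (p : ℝ≥0∞) : ℝ≥0∞ :=
  ⨆ f ∈ N, ⨅ t ∈ trigPolys (n - 1), perNorm p (fun x => f x - t x)

/-- The set `B`: positive nonincreasing functions on `[1, ∞)` with `ψ(t)/ψ(2t)` bounded. -/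
def classB : Set (ℝ → ℝ) :=
  {ψ | AntitoneOn ψ (Ici 1) ∧ (∀ t : ℝ, 1 ≤ t → 0 < ψ t) ∧
    ∃ K : ℝ, 0 < K ∧ ∀ t : ℝ, 1 ≤ t → ψ t / ψ (2 * t) ≤ K}

/-- The set `Θ_q`, `1 ≤ q < ∞`: nonincreasing functions on `[1, ∞)` such that `t^α ψ(t)` is almost
decreasing for some `α > 1/q`. -/
def classTheta (q : ℝ) : Set (ℝ → ℝ) :=
  {ψ | AntitoneOn ψ (Ici 1) ∧
    ∃ α : ℝ, 1 / q < α ∧ ∃ K : ℝ, 0 < K ∧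
      ∀ t₁ t₂ : ℝ, 1 ≤ t₂ → t₂ < t₁ → t₁ ^ α * ψ t₁ ≤ K * (t₂ ^ α * ψ t₂)}

/-- The second difference `Δ²(1/ψ(k)) = 1/ψ(k) - 2/ψ(k+1) + 1/ψ(k+2)`. -/
def secondDiffInv (ψ : ℝ → ℝ) (k : ℕ) : ℝ :=
  1 / ψ (k : ℝ) - 2 / ψ ((k : ℝ) + 1) + 1 / ψ ((k : ℝ) + 2)

end

/-!
If `f = a₀ / 2 + (1 / π) Ψ_β ∗ φ` with `‖φ‖₁ ≤ 1`, then `f - S_{n-1} f` is `(1 / π)` times the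
convolution of `Ψ_β - S_{n-1} Ψ_β` with `φ`, so by Young's inequality the upper bound only concerns
`‖Ψ_β - S_{n-1} Ψ_β‖_p`. Summation by parts together with the almost decrease of `k ^ α ψ k` bounds
this remainder at `x` by a constant multiple of `n ψ n` times a fixed power-law profile evaluated at
`n x`; rescaling the `L_p` norm of the profile produces `ψ n * n ^ (1 - 1 / p)`.

For the lower bound take `φ` to be a multiple of a Fejér kernel without its constant term. Pairing
`f - t` with a Fejér kernel modulated to the frequency `2 n` annihilates every polynomial `t` of
order less than `n` and picks out of `f` a weighted sum of the `ψ k` with `n ≤ k ≤ 3 n`, which are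
all comparable to `ψ n`. The conjugate norm of the test function has order `n ^ (1 / p)`, and
Hölder's inequality concludes.
-/

open Filter Topology

/-! ### Integral operators on `L_1` -/

theorem rpow_lintegral_le_lintegral_rpow_mul {Y : Type*} [MeasurableSpace Y] {ν : Measure Y}
    {g : Y → ℝ≥0∞} (hg : AEMeasurable g ν) {q : ℝ} (hq : 1 ≤ q) :
    (∫⁻ t, g t ∂ν) ^ q ≤ (∫⁻ t, g t ^ q ∂ν) * ν univ ^ (q - 1) := by
  have hq_pos : 0 < q := zero_lt_one.trans_le hq
  have h := eLpNorm'_le_eLpNorm'_mul_rpow_measure_univ zero_lt_one hq hg.aestronglyMeasurable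
  simp only [eLpNorm', enorm_eq_self, ENNReal.rpow_one, div_one] at h
  refine (ENNReal.rpow_le_rpow h hq_pos.le).trans_eq ?_
  rw [ENNReal.mul_rpow_of_nonneg _ _ hq_pos.le, ← ENNReal.rpow_mul, ← ENNReal.rpow_mul,
    one_div_mul_cancel hq_pos.ne', ENNReal.rpow_one, sub_mul, one_mul,
    one_div_mul_cancel hq_pos.ne']

section IntegralOperator

variable {X Y : Type*} [MeasurableSpace X] [MeasurableSpace Y] {μ : Measure X} {ν : Measure Y}
  [SFinite μ] {F : X × Y → ℝ≥0∞} {M : ℝ≥0∞}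

theorem ae_lintegral_le_of_forall_ae_le [SFinite ν] (hF : AEMeasurable F (μ.prod ν))
    (hM : ∀ t, ∀ᵐ x ∂μ, F (x, t) ≤ M) : ∀ᵐ x ∂μ, ∫⁻ t, F (x, t) ∂ν ≤ M * ν univ := by
  have hexcess_meas : AEMeasurable (fun z => F z - M) (μ.prod ν) := hF.sub aemeasurable_const
  have hexcess : ∫⁻ x, ∫⁻ t, (F (x, t) - M) ∂ν ∂μ = 0 := by
    rw [lintegral_lintegral_swap (f := fun x t => F (x, t) - M) hexcess_meas]
    refine (lintegral_congr fun t => ?_).trans lintegral_zero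
    exact (lintegral_congr_ae ((hM t).mono fun x hx => tsub_eq_zero_of_le hx)).trans lintegral_zero
  rw [lintegral_eq_zero_iff' hexcess_meas.lintegral_prod_right'] at hexcess
  filter_upwards [hexcess, hexcess_meas.aestronglyMeasurable.prodMk_left] with x hx hx_meas
  rw [Pi.zero_apply, lintegral_eq_zero_iff' hx_meas.aemeasurable] at hx
  calc ∫⁻ t, F (x, t) ∂ν ≤ ∫⁻ _, M ∂ν :=
        lintegral_mono_ae (hx.mono fun t ht => tsub_eq_zero_iff_le.1 ht)
    _ = M * ν univ := lintegral_const M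

theorem eLpNorm_lintegral_le [IsFiniteMeasure ν] (hF : AEMeasurable F (μ.prod ν)) {p : ℝ≥0∞}
    (hp : 1 ≤ p) (hM : ∀ t, eLpNorm (fun x => F (x, t)) p μ ≤ M) :
    eLpNorm (fun x => ∫⁻ t, F (x, t) ∂ν) p μ ≤ M * ν univ := by
  rcases eq_or_ne p ∞ with rfl | hp_top
  · refine essSup_le_of_ae_le _ (ae_lintegral_le_of_forall_ae_le hF fun t => ?_)
    exact (ae_le_eLpNormEssSup (ε := ℝ≥0∞)).mono fun x hx => hx.trans (hM t)
  have hp_zero : p ≠ 0 := (zero_lt_one.trans_le hp).ne'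
  set q := p.toReal
  have hq : 1 ≤ q := ENNReal.toReal_mono hp_top hp
  have hq_pos : 0 < q := zero_lt_one.trans_le hq
  have eLpNorm_le_iff {G : X → ℝ≥0∞} {N : ℝ≥0∞} :
      eLpNorm G p μ ≤ N ↔ ∫⁻ x, G x ^ q ∂μ ≤ N ^ q := by
    rw [eLpNorm_eq_lintegral_rpow_enorm_toReal hp_zero hp_top, one_div,
      ENNReal.rpow_inv_le_iff hq_pos]
    rfl
  rw [eLpNorm_le_iff]
  calc ∫⁻ x, (∫⁻ t, F (x, t) ∂ν) ^ q ∂μ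
      ≤ ∫⁻ x, (∫⁻ t, F (x, t) ^ q ∂ν) * ν univ ^ (q - 1) ∂μ := by
        refine lintegral_mono_ae (hF.aestronglyMeasurable.prodMk_left.mono fun x hx => ?_)
        exact rpow_lintegral_le_lintegral_rpow_mul hx.aemeasurable hq
    _ = (∫⁻ t, ∫⁻ x, F (x, t) ^ q ∂μ ∂ν) * ν univ ^ (q - 1) := by
        rw [lintegral_mul_const'' _ (hF.pow_const q).lintegral_prod_right',
          lintegral_lintegral_swap (hF.pow_const q)]
    _ ≤ M ^ q * ν univ * ν univ ^ (q - 1) := by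
        gcongr
        exact (lintegral_mono fun t => eLpNorm_le_iff.1 (hM t)).trans_eq (lintegral_const _)
    _ = (M * ν univ) ^ q := by
        rw [ENNReal.mul_rpow_of_nonneg _ _ hq_pos.le, mul_assoc]
        nth_rewrite 1 [← ENNReal.rpow_one (ν univ)]
        rw [← ENNReal.rpow_add_of_nonneg _ _ zero_le_one (sub_nonneg.2 hq), add_sub_cancel]

/-- This is `eLpNorm_lintegral_le` for the measure `|φ| dν`. -/
theorem eLpNorm_integral_mul_le [SFinite ν] {K : X × Y → ℝ} {φ : Y → ℝ}
    (hK : AEStronglyMeasurable K (μ.prod ν)) (hφ : Integrable φ ν) {p : ℝ≥0∞} (hp : 1 ≤ p)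
    (hM : ∀ t, eLpNorm (fun x => K (x, t)) p μ ≤ M) :
    eLpNorm (fun x => ∫ t, K (x, t) * φ t ∂ν) p μ ≤ M * eLpNorm φ 1 ν := by
  have hφ_meas : AEMeasurable (fun t => ‖φ t‖ₑ) ν := hφ.aestronglyMeasurable.enorm
  set ρ := ν.withDensity fun t => ‖φ t‖ₑ
  have hρ_univ : ρ univ = eLpNorm φ 1 ν := by
    simp only [ρ, withDensity_apply _ MeasurableSet.univ, Measure.restrict_univ,
      eLpNorm_one_eq_lintegral_enorm]
  have : IsFiniteMeasure ρ := ⟨hρ_univ ▸ (memLp_one_iff_integrable.2 hφ).2⟩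
  have hKρ : AEMeasurable (fun z => ‖K z‖ₑ) (μ.prod ρ) :=
    hK.enorm.mono_ac (Measure.AbsolutelyContinuous.rfl.prod (withDensity_absolutelyContinuous _ _))
  have hpointwise : ∀ᵐ x ∂μ, ‖∫ t, K (x, t) * φ t ∂ν‖ₑ ≤ ‖∫⁻ t, ‖K (x, t)‖ₑ ∂ρ‖ₑ := by
    filter_upwards [hK.prodMk_left] with x hx
    rw [enorm_eq_self, lintegral_withDensity_eq_lintegral_mul₀ hφ_meas hx.enorm]
    refine (enorm_integral_le_lintegral_enorm _).trans_eq (lintegral_congr fun t => ?_)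
    rw [enorm_mul, mul_comm, Pi.mul_apply]
  calc eLpNorm (fun x => ∫ t, K (x, t) * φ t ∂ν) p μ
      ≤ eLpNorm (fun x => ∫⁻ t, ‖K (x, t)‖ₑ ∂ρ) p μ := eLpNorm_mono_enorm_ae hpointwise
    _ ≤ M * ρ univ := eLpNorm_lintegral_le hKρ hp fun t => by
        simpa only [eLpNorm_enorm] using hM t
    _ = M * eLpNorm φ 1 ν := by rw [hρ_univ]

end IntegralOperator

/-! ### Periodic functions and their convolution -/

theorem eLpNorm_restrict_Ioc_of_periodic {E : Type*} [NormedAddCommGroup E] {f : ℝ → E} {T : ℝ}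
    (hT : 0 < T) (hf : Function.Periodic f T) (p : ℝ≥0∞) (a b : ℝ) :
    eLpNorm f p (volume.restrict (Ioc a (a + T))) =
      eLpNorm f p (volume.restrict (Ioc b (b + T))) := by
  have ha := isAddFundamentalDomain_Ioc hT a
  have hb := isAddFundamentalDomain_Ioc hT b
  have hf_inv (g : AddSubgroup.zmultiples T) (x : ℝ) : f (g +ᵥ x) = f x := by
    obtain ⟨_, n, rfl⟩ := g
    simpa [AddSubgroup.vadd_def, add_comm] using! hf.zsmul n x
  rcases eq_or_ne p 0 with rfl | hp_zero
  · simp only [eLpNorm_exponent_zero]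
  rcases eq_or_ne p ∞ with rfl | hp_top
  · rw [eLpNorm_exponent_top, eLpNorm_exponent_top, eLpNormEssSup, eLpNormEssSup,
      ha.essSup_measure_restrict fun g x => by rw [hf_inv],
      hb.essSup_measure_restrict fun g x => by rw [hf_inv]]
  · rw [eLpNorm_eq_lintegral_rpow_enorm_toReal hp_zero hp_top,
      eLpNorm_eq_lintegral_rpow_enorm_toReal hp_zero hp_top,
      ha.setLIntegral_eq hb _ fun g x => by rw [hf_inv]]

/-- Lebesgue measure on the period `(-π, π]`, over which the Fourier coefficients and the
convolutions are written; it gives periodic functions the same norms as `periodMeasure`. -/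
noncomputable def symPeriodMeasure : Measure ℝ := volume.restrict (Ioc (-π) π)

instance : IsFiniteMeasure symPeriodMeasure := by
  unfold symPeriodMeasure; infer_instance

theorem intervalIntegral_eq_integral_symPeriodMeasure (f : ℝ → ℝ) :
    ∫ t in (-π)..π, f t = ∫ t, f t ∂symPeriodMeasure :=
  intervalIntegral.integral_of_le (neg_le_self Real.pi_pos.le)

theorem intervalIntegrable_iff_integrable_symPeriodMeasure {f : ℝ → ℝ} :
    IntervalIntegrable f volume (-π) π ↔ Integrable f symPeriodMeasure :=
  intervalIntegrable_iff_integrableOn_Ioc_of_le (neg_le_self Real.pi_pos.le)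

theorem perNorm_eq_eLpNorm_Ioc {f : ℝ → ℝ} (hf : Function.Periodic f (2 * π)) (p : ℝ≥0∞) (a : ℝ) :
    perNorm p f = eLpNorm f p (volume.restrict (Ioc a (a + 2 * π))) := by
  simpa only [zero_add] using! eLpNorm_restrict_Ioc_of_periodic Real.two_pi_pos hf p 0 a

theorem perNorm_eq_eLpNorm_symPeriodMeasure {f : ℝ → ℝ} (hf : Function.Periodic f (2 * π))
    (p : ℝ≥0∞) : perNorm p f = eLpNorm f p symPeriodMeasure := by
  rw [perNorm_eq_eLpNorm_Ioc hf p (-π), symPeriodMeasure, show -π + 2 * π = π by ring]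

theorem MemPerLp.intervalIntegrable {f : ℝ → ℝ} (hf : MemPerLp 1 f) (a b : ℝ) :
    IntervalIntegrable f volume a b := by
  refine hf.1.intervalIntegrable₀ Real.two_pi_pos.ne' ?_ a b
  rw [intervalIntegrable_iff_integrableOn_Ioc_of_le Real.two_pi_pos.le]
  exact memLp_one_iff_integrable.1 hf.2

theorem MemPerLp.integrable {f : ℝ → ℝ} (hf : MemPerLp 1 f) : Integrable f symPeriodMeasure :=
  intervalIntegrable_iff_integrable_symPeriodMeasure.1 (hf.intervalIntegrable (-π) π)

theorem memPerLp_one_of_integrable {f : ℝ → ℝ} (hf : Function.Periodic f (2 * π))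
    (hf_int : Integrable f symPeriodMeasure) : MemPerLp 1 f := by
  refine ⟨hf, memLp_one_iff_integrable.2 ?_⟩
  have h := hf.intervalIntegrable Real.two_pi_pos.ne' (t := -π) (by
    rw [show -π + 2 * π = π by ring]
    exact intervalIntegrable_iff_integrable_symPeriodMeasure.2 hf_int) 0 (2 * π)
  exact (intervalIntegrable_iff_integrableOn_Ioc_of_le Real.two_pi_pos.le).1 h

theorem memPerLp_one_of_continuous {f : ℝ → ℝ} (hf : Function.Periodic f (2 * π))
    (hf_cont : Continuous f) : MemPerLp 1 f :=
  memPerLp_one_of_integrable hf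
    (intervalIntegrable_iff_integrable_symPeriodMeasure.1 (hf_cont.intervalIntegrable _ _))

theorem MemPerLp.aestronglyMeasurable {f : ℝ → ℝ} (hf : MemPerLp 1 f) :
    AEStronglyMeasurable f volume := by
  rw [← Measure.restrict_univ (μ := volume), ← iUnion_Ioc_intCast, aestronglyMeasurable_iUnion_iff]
  exact fun n => (hf.intervalIntegrable n (n + 1)).aestronglyMeasurable

theorem eLpNorm_comp_sub_symPeriodMeasure {f : ℝ → ℝ} (hf : MemPerLp 1 f) (p : ℝ≥0∞) (t : ℝ) :
    eLpNorm (fun x => f (x - t)) p symPeriodMeasure = perNorm p f := by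
  have hshift : MeasurePreserving (· - t) symPeriodMeasure
      (volume.restrict (Ioc (-π - t) (-π - t + 2 * π))) := by
    have h := (measurePreserving_sub_right volume t).restrict_preimage
      (s := Ioc (-π - t) (-π - t + 2 * π)) measurableSet_Ioc
    rwa [preimage_sub_const_Ioc, sub_add_cancel,
      show -π - t + 2 * π + t = π by ring] at h
  rw [perNorm_eq_eLpNorm_Ioc hf.1 p (-π - t)]
  exact eLpNorm_comp_measurePreserving hf.aestronglyMeasurable.restrict hshift

theorem MemPerLp.aestronglyMeasurable_comp_sub {f : ℝ → ℝ} (hf : MemPerLp 1 f) :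
    AEStronglyMeasurable (fun z : ℝ × ℝ => f (z.1 - z.2))
      (symPeriodMeasure.prod symPeriodMeasure) := by
  refine hf.aestronglyMeasurable.comp_quasiMeasurePreserving ?_
  refine (quasiMeasurePreserving_sub_of_right_invariant volume symPeriodMeasure).mono_left ?_
  exact (Measure.absolutelyContinuous_of_le Measure.restrict_le_self).prod .rfl

theorem integrable_comp_sub_mul {Ψ φ : ℝ → ℝ} (hΨ : MemPerLp 1 Ψ) (hφ : MemPerLp 1 φ) :
    Integrable (fun z : ℝ × ℝ => Ψ (z.1 - z.2) * φ z.2)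
      (symPeriodMeasure.prod symPeriodMeasure) := by
  have hmeas : AEStronglyMeasurable (fun z : ℝ × ℝ => Ψ (z.1 - z.2) * φ z.2)
      (symPeriodMeasure.prod symPeriodMeasure) :=
    hΨ.aestronglyMeasurable_comp_sub.mul hφ.integrable.aestronglyMeasurable.comp_snd
  refine ⟨hmeas, hasFiniteIntegral_iff_enorm.2 ?_⟩
  calc ∫⁻ z : ℝ × ℝ, ‖Ψ (z.1 - z.2) * φ z.2‖ₑ ∂symPeriodMeasure.prod symPeriodMeasure
      = ∫⁻ t, ∫⁻ x, ‖Ψ (x - t)‖ₑ * ‖φ t‖ₑ ∂symPeriodMeasure ∂symPeriodMeasure := by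
        rw [lintegral_prod_symm _ hmeas.enorm]
        simp only [enorm_mul]
    _ = ∫⁻ t, perNorm 1 Ψ * ‖φ t‖ₑ ∂symPeriodMeasure := by
        refine lintegral_congr fun t => ?_
        rw [lintegral_mul_const' _ _ enorm_ne_top, ← eLpNorm_comp_sub_symPeriodMeasure hΨ 1 t,
          eLpNorm_one_eq_lintegral_enorm]
    _ = perNorm 1 Ψ * ∫⁻ t, ‖φ t‖ₑ ∂symPeriodMeasure := lintegral_const_mul' _ _ hΨ.2.2.ne
    _ < ∞ := ENNReal.mul_lt_top hΨ.2.2 hφ.integrable.2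

/-- The convolution `∫_{-π}^{π} Ψ(x - t) φ(t) dt` of `2π`-periodic functions. -/
noncomputable def perConv (Ψ φ : ℝ → ℝ) (x : ℝ) : ℝ := ∫ t in (-π)..π, Ψ (x - t) * φ t

theorem perConv_eq_integral (Ψ φ : ℝ → ℝ) (x : ℝ) :
    perConv Ψ φ x = ∫ t, Ψ (x - t) * φ t ∂symPeriodMeasure :=
  intervalIntegral_eq_integral_symPeriodMeasure _

theorem perConv_periodic {Ψ : ℝ → ℝ} (hΨ : Function.Periodic Ψ (2 * π)) (φ : ℝ → ℝ) :
    Function.Periodic (perConv Ψ φ) (2 * π) := fun x => by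
  simp only [perConv, add_sub_right_comm, hΨ (x - _)]

theorem MemPerLp.perConv {Ψ φ : ℝ → ℝ} (hΨ : MemPerLp 1 Ψ) (hφ : MemPerLp 1 φ) :
    MemPerLp 1 (perConv Ψ φ) := by
  refine memPerLp_one_of_integrable (perConv_periodic hΨ.1 φ) ?_
  simpa only [← perConv_eq_integral] using! (integrable_comp_sub_mul hΨ hφ).integral_prod_left

theorem perNorm_perConv_le {Ψ φ : ℝ → ℝ} (hΨ : MemPerLp 1 Ψ) (hφ : MemPerLp 1 φ) {p : ℝ≥0∞}
    (hp : 1 ≤ p) : perNorm p (perConv Ψ φ) ≤ perNorm p Ψ * perNorm 1 φ := by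
  rw [perNorm_eq_eLpNorm_symPeriodMeasure (perConv_periodic hΨ.1 φ),
    perNorm_eq_eLpNorm_symPeriodMeasure hφ.1, funext (perConv_eq_integral Ψ φ)]
  exact eLpNorm_integral_mul_le hΨ.aestronglyMeasurable_comp_sub hφ.integrable hp fun t =>
    (eLpNorm_comp_sub_symPeriodMeasure hΨ p t).le

/-! ### Fourier coefficients with a phase -/

/-- The Fourier coefficient of `f` against `cos (k t - c)`, that is `a_k cos c + b_k sin c`. The
phase `c` treats cosine and sine coefficients together: they are the cases `c = 0` and `c = π / 2`,
and `c = k x` gives the `k`-th term of the Fourier series at `x`. -/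
noncomputable def phaseCoeff (f : ℝ → ℝ) (k : ℕ) (c : ℝ) : ℝ :=
  1 / π * ∫ t, f t * Real.cos (k * t - c) ∂symPeriodMeasure

theorem integrable_mul_cos {X : Type*} [MeasurableSpace X] {μ : Measure X} {f g : X → ℝ}
    (hf : Integrable f μ) (hg : AEStronglyMeasurable g μ) :
    Integrable (fun x => f x * Real.cos (g x)) μ :=
  hf.mul_bdd (c := 1) (Real.continuous_cos.comp_aestronglyMeasurable hg)
    (Eventually.of_forall fun _ => Real.abs_cos_le_one _)

theorem integrable_mul_cos_sub {f : ℝ → ℝ} (hf : Integrable f symPeriodMeasure) (k c : ℝ) :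
    Integrable (fun t => f t * Real.cos (k * t - c)) symPeriodMeasure :=
  integrable_mul_cos hf (by fun_prop)

theorem pi_mul_phaseCoeff (f : ℝ → ℝ) (k : ℕ) (c : ℝ) :
    π * phaseCoeff f k c = ∫ t, f t * Real.cos (k * t - c) ∂symPeriodMeasure := by
  rw [phaseCoeff, ← mul_assoc, mul_one_div_cancel Real.pi_ne_zero, one_mul]

theorem phaseCoeff_zero_right (f : ℝ → ℝ) (k : ℕ) : phaseCoeff f k 0 = cosCoeff f k := by
  simp only [phaseCoeff, cosCoeff, intervalIntegral_eq_integral_symPeriodMeasure, sub_zero]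

theorem phaseCoeff_pi_div_two (f : ℝ → ℝ) (k : ℕ) : phaseCoeff f k (π / 2) = sinCoeff f k := by
  simp only [phaseCoeff, sinCoeff, intervalIntegral_eq_integral_symPeriodMeasure,
    Real.cos_sub_pi_div_two]

theorem phaseCoeff_eq {f : ℝ → ℝ} (hf : Integrable f symPeriodMeasure) (k : ℕ) (c : ℝ) :
    phaseCoeff f k c = cosCoeff f k * Real.cos c + sinCoeff f k * Real.sin c := by
  have hcos := (integrable_mul_cos_sub hf k 0).mul_const (Real.cos c)
  have hsin := (integrable_mul_cos_sub hf k (π / 2)).mul_const (Real.sin c)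
  rw [← phaseCoeff_zero_right, ← phaseCoeff_pi_div_two, phaseCoeff, phaseCoeff, phaseCoeff,
    mul_assoc, mul_assoc, ← mul_add, ← integral_mul_const, ← integral_mul_const,
    ← integral_add hcos hsin]
  congr 2
  ext t
  rw [sub_zero, Real.cos_sub_pi_div_two, Real.cos_sub]
  ring

theorem phaseCoeff_congr_ae {f g : ℝ → ℝ} (h : f =ᵐ[symPeriodMeasure] g) (k : ℕ) (c : ℝ) :
    phaseCoeff f k c = phaseCoeff g k c := by
  have h_mul : (fun t => f t * Real.cos (k * t - c)) =ᵐ[symPeriodMeasure]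
      fun t => g t * Real.cos (k * t - c) := h.mono fun t ht => by simp only [ht]
  rw [phaseCoeff, phaseCoeff, integral_congr_ae h_mul]

theorem phaseCoeff_add {f g : ℝ → ℝ} (hf : Integrable f symPeriodMeasure)
    (hg : Integrable g symPeriodMeasure) (k : ℕ) (c : ℝ) :
    phaseCoeff (fun t => f t + g t) k c = phaseCoeff f k c + phaseCoeff g k c := by
  simp only [phaseCoeff, add_mul]
  rw [integral_add (integrable_mul_cos_sub hf k c) (integrable_mul_cos_sub hg k c), mul_add]

theorem phaseCoeff_sub {f g : ℝ → ℝ} (hf : Integrable f symPeriodMeasure)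
    (hg : Integrable g symPeriodMeasure) (k : ℕ) (c : ℝ) :
    phaseCoeff (fun t => f t - g t) k c = phaseCoeff f k c - phaseCoeff g k c := by
  simp only [phaseCoeff, sub_mul]
  rw [integral_sub (integrable_mul_cos_sub hf k c) (integrable_mul_cos_sub hg k c), mul_sub]

theorem phaseCoeff_const_mul (a : ℝ) (f : ℝ → ℝ) (k : ℕ) (c : ℝ) :
    phaseCoeff (fun t => a * f t) k c = a * phaseCoeff f k c := by
  simp only [phaseCoeff, mul_assoc, integral_const_mul]
  ring

theorem integral_const_symPeriodMeasure (a : ℝ) : ∫ _, a ∂symPeriodMeasure = 2 * π * a := by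
  rw [← intervalIntegral_eq_integral_symPeriodMeasure, intervalIntegral.integral_const, smul_eq_mul]
  ring

theorem integral_cos_int_mul_add {l : ℤ} (hl : l ≠ 0) (c : ℝ) :
    ∫ x, Real.cos (l * x + c) ∂symPeriodMeasure = 0 := by
  have hl' : (l : ℝ) ≠ 0 := by exact_mod_cast hl
  rw [← intervalIntegral_eq_integral_symPeriodMeasure,
    intervalIntegral.integral_comp_mul_add (fun x => Real.cos x) hl', integral_cos,
    show (l : ℝ) * π + c = l * -π + c + l * (2 * π) by ring, Real.sin_add_int_mul_two_pi,
    sub_self, smul_zero]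

theorem phaseCoeff_cos {j k : ℕ} (hjk : 0 < j + k) (γ c : ℝ) :
    phaseCoeff (fun t => Real.cos (j * t - γ)) k c = if j = k then Real.cos (c - γ) else 0 := by
  have hprod (t : ℝ) : Real.cos (j * t - γ) * Real.cos (k * t - c) =
      1 / 2 * Real.cos (((j - k : ℤ) : ℝ) * t + (c - γ)) +
        1 / 2 * Real.cos (((j + k : ℤ) : ℝ) * t + (-γ - c)) := by
    push_cast
    rw [show ((j : ℝ) - k) * t + (c - γ) = (j * t - γ) - (k * t - c) by ring,
      show ((j : ℝ) + k) * t + (-γ - c) = (j * t - γ) + (k * t - c) by ring,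
      Real.cos_sub (j * t - γ), Real.cos_add (j * t - γ)]
    ring
  have hint (l : ℤ) (c : ℝ) :
      Integrable (fun t : ℝ => 1 / 2 * Real.cos (l * t + c)) symPeriodMeasure := by
    simpa only [sub_neg_eq_add] using! integrable_mul_cos_sub (integrable_const (1 / 2)) l (-c)
  rw [phaseCoeff]
  simp only [hprod]
  rw [integral_add (hint _ _) (hint _ _), integral_const_mul, integral_const_mul,
    integral_cos_int_mul_add (l := (j + k : ℤ)) (by omega)]
  split_ifs with h
  · simp only [h, sub_self, Int.cast_zero, zero_mul, zero_add, integral_const_symPeriodMeasure]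
    field_simp
    ring
  · rw [integral_cos_int_mul_add (l := (j - k : ℤ)) (by omega)]
    ring

theorem phaseCoeff_const (a : ℝ) (k : ℕ) (c : ℝ) :
    phaseCoeff (fun _ => a) k c = if k = 0 then 2 * a * Real.cos c else 0 := by
  rw [phaseCoeff, integral_const_mul]
  split_ifs with hk
  · simp only [hk, Nat.cast_zero, zero_mul, zero_sub, Real.cos_neg, integral_const_symPeriodMeasure]
    field_simp
  · have h := integral_cos_int_mul_add (l := k) (by exact_mod_cast hk) (-c)
    rw [Int.cast_natCast] at h
    simp only [sub_eq_add_neg, h, mul_zero]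

theorem cos_nat_mul_sub_periodic (k : ℕ) (c : ℝ) :
    Function.Periodic (fun x : ℝ => Real.cos (k * x - c)) (2 * π) := fun x => by
  simp only
  rw [show (k : ℝ) * (x + 2 * π) - c = k * x - c + k * (2 * π) by ring, Real.cos_add_nat_mul_two_pi]

/-! ### Trigonometric polynomials and Fourier sums -/

/-- The trigonometric polynomial `∑_{k=1}^{N} u_k cos (k x - γ)`. -/
noncomputable def cosPartialSum (u : ℕ → ℝ) (γ : ℝ) (N : ℕ) (x : ℝ) : ℝ :=
  ∑ k ∈ Finset.Icc 1 N, u k * Real.cos (k * x - γ)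

section CosPartialSum

variable (u : ℕ → ℝ) (γ : ℝ) (N : ℕ)

theorem continuous_cosPartialSum : Continuous (cosPartialSum u γ N) := by
  unfold cosPartialSum; fun_prop

theorem cosPartialSum_periodic : Function.Periodic (cosPartialSum u γ N) (2 * π) := fun x =>
  Finset.sum_congr rfl fun k _ => congrArg (u k * ·) (cos_nat_mul_sub_periodic k γ x)

theorem memPerLp_cosPartialSum : MemPerLp 1 (cosPartialSum u γ N) :=
  memPerLp_one_of_continuous (cosPartialSum_periodic u γ N) (continuous_cosPartialSum u γ N)

theorem phaseCoeff_cosPartialSum (k : ℕ) (c : ℝ) :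
    phaseCoeff (cosPartialSum u γ N) k c =
      if k ∈ Finset.Icc 1 N then u k * Real.cos (c - γ) else 0 := by
  have hint (j : ℕ) : Integrable (fun t : ℝ => u j * Real.cos (j * t - γ) * Real.cos (k * t - c))
      symPeriodMeasure :=
    integrable_mul_cos_sub (integrable_mul_cos_sub (integrable_const (u j)) j γ) k c
  have hterm : ∀ j ∈ Finset.Icc 1 N, phaseCoeff (fun t => u j * Real.cos (j * t - γ)) k c =
      if j = k then u j * Real.cos (c - γ) else 0 := fun j hj => by
    rw [phaseCoeff_const_mul, phaseCoeff_cos (by linarith [(Finset.mem_Icc.1 hj).1]), mul_ite,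
      mul_zero]
  calc phaseCoeff (cosPartialSum u γ N) k c
      = ∑ j ∈ Finset.Icc 1 N, phaseCoeff (fun t => u j * Real.cos (j * t - γ)) k c := by
        simp only [phaseCoeff, cosPartialSum, Finset.sum_mul]
        rw [integral_finsetSum _ fun j _ => hint j, Finset.mul_sum]
    _ = _ := by rw [Finset.sum_congr rfl hterm, Finset.sum_ite_eq']

end CosPartialSum

theorem eq_const_add_cosPartialSum_of_mem_trigPolys {m : ℕ} {t : ℝ → ℝ} (ht : t ∈ trigPolys m) :
    ∃ (c : ℝ) (a b : ℕ → ℝ),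
      t = fun x => c + (cosPartialSum a 0 m x + cosPartialSum b (π / 2) m x) := by
  obtain ⟨c, a, b, h⟩ := ht
  refine ⟨c, a, b, funext fun x => ?_⟩
  simp only [h x, cosPartialSum, sub_zero, Real.cos_sub_pi_div_two, Finset.sum_add_distrib]

theorem memPerLp_of_mem_trigPolys {m : ℕ} {t : ℝ → ℝ} (ht : t ∈ trigPolys m) : MemPerLp 1 t := by
  obtain ⟨c, a, b, rfl⟩ := eq_const_add_cosPartialSum_of_mem_trigPolys ht
  refine memPerLp_one_of_continuous (fun x => ?_) (continuous_const.add
    ((continuous_cosPartialSum a 0 m).add (continuous_cosPartialSum b (π / 2) m)))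
  simp only [cosPartialSum_periodic a 0 m x, cosPartialSum_periodic b (π / 2) m x]

theorem phaseCoeff_eq_zero_of_mem_trigPolys {m k : ℕ} {t : ℝ → ℝ} (ht : t ∈ trigPolys m)
    (hk : m < k) (c : ℝ) : phaseCoeff t k c = 0 := by
  obtain ⟨c₀, a, b, rfl⟩ := eq_const_add_cosPartialSum_of_mem_trigPolys ht
  have ha := (memPerLp_cosPartialSum a 0 m).integrable
  have hb := (memPerLp_cosPartialSum b (π / 2) m).integrable
  have hk_notMem : k ∉ Finset.Icc 1 m := by simp only [Finset.mem_Icc]; omega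
  rw [phaseCoeff_add (integrable_const c₀) (by exact ha.add hb), phaseCoeff_add ha hb,
    phaseCoeff_const, phaseCoeff_cosPartialSum, phaseCoeff_cosPartialSum, if_neg (by omega),
    if_neg hk_notMem, if_neg hk_notMem, add_zero, add_zero]

theorem fourierSum_mem_trigPolys (m : ℕ) (f : ℝ → ℝ) : fourierSum m f ∈ trigPolys m :=
  ⟨cosCoeff f 0 / 2, cosCoeff f, sinCoeff f, fun _ => rfl⟩

theorem fourierSum_eq_sum_phaseCoeff {f : ℝ → ℝ} (hf : Integrable f symPeriodMeasure) (m : ℕ)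
    (x : ℝ) : fourierSum m f x =
      phaseCoeff f 0 0 / 2 + ∑ k ∈ Finset.Icc 1 m, phaseCoeff f k (k * x) := by
  simp only [fourierSum, phaseCoeff_zero_right, phaseCoeff_eq hf _ (_ * x)]

theorem fourierSum_congr_ae {f g : ℝ → ℝ} (h : f =ᵐ[symPeriodMeasure] g) (m : ℕ) :
    fourierSum m f = fourierSum m g := by
  ext x
  simp only [fourierSum, ← phaseCoeff_zero_right, ← phaseCoeff_pi_div_two, phaseCoeff_congr_ae h]

theorem fourierSum_const_add_const_mul {g : ℝ → ℝ} (hg : Integrable g symPeriodMeasure) (a b : ℝ)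
    (m : ℕ) (x : ℝ) : fourierSum m (fun t => a + b * g t) x = a + b * fourierSum m g x := by
  have ha : Integrable (fun _ : ℝ => a) symPeriodMeasure := integrable_const a
  have hbg := hg.const_mul b
  have hsum : ∑ k ∈ Finset.Icc 1 m, phaseCoeff (fun _ => a) k (k * x) = 0 :=
    Finset.sum_eq_zero fun k hk => by
      rw [phaseCoeff_const, if_neg (by linarith [(Finset.mem_Icc.1 hk).1])]
  rw [fourierSum_eq_sum_phaseCoeff (by exact ha.add hbg), fourierSum_eq_sum_phaseCoeff hg]
  simp only [phaseCoeff_add ha hbg, phaseCoeff_const_mul, Finset.sum_add_distrib, hsum,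
    ← Finset.mul_sum]
  rw [phaseCoeff_const, if_pos rfl, Real.cos_zero]
  ring

theorem phaseCoeff_comp_sub {Ψ : ℝ → ℝ} (hΨ : Function.Periodic Ψ (2 * π)) (k : ℕ) (c t : ℝ) :
    phaseCoeff (fun x => Ψ (x - t)) k c = phaseCoeff Ψ k (c - k * t) := by
  set h : ℝ → ℝ := fun u => Ψ u * Real.cos (k * u - (c - k * t)) with h_def
  have hper : Function.Periodic h (2 * π) := hΨ.mul (cos_nat_mul_sub_periodic k _)
  have hshift (x : ℝ) : Ψ (x - t) * Real.cos (k * x - c) = h (x - t) := by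
    rw [h_def]
    ring_nf
  have hperiod := hper.intervalIntegral_add_eq (-π - t) (-π)
  rw [show -π - t + 2 * π = π - t by ring, show -π + 2 * π = π by ring] at hperiod
  simp only [phaseCoeff, hshift]
  rw [← intervalIntegral_eq_integral_symPeriodMeasure, intervalIntegral.integral_comp_sub_right,
    hperiod, intervalIntegral_eq_integral_symPeriodMeasure]

theorem phaseCoeff_perConv {Ψ φ : ℝ → ℝ} (hΨ : MemPerLp 1 Ψ) (hφ : MemPerLp 1 φ) (k : ℕ) (c : ℝ) :
    phaseCoeff (perConv Ψ φ) k c = ∫ t, phaseCoeff Ψ k (c - k * t) * φ t ∂symPeriodMeasure := by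
  have hint : Integrable (fun z : ℝ × ℝ => Ψ (z.1 - z.2) * φ z.2 * Real.cos (k * z.1 - c))
      (symPeriodMeasure.prod symPeriodMeasure) :=
    integrable_mul_cos (integrable_comp_sub_mul hΨ hφ) (by fun_prop)
  calc phaseCoeff (perConv Ψ φ) k c
      = 1 / π * ∫ x, ∫ t, Ψ (x - t) * φ t * Real.cos (k * x - c)
          ∂symPeriodMeasure ∂symPeriodMeasure := by
        simp only [phaseCoeff, perConv_eq_integral, integral_mul_const]
    _ = 1 / π * ∫ t, ∫ x, Ψ (x - t) * φ t * Real.cos (k * x - c)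
          ∂symPeriodMeasure ∂symPeriodMeasure := by
        rw [integral_integral_swap hint]
    _ = ∫ t, phaseCoeff Ψ k (c - k * t) * φ t ∂symPeriodMeasure := by
        rw [← integral_const_mul]
        refine integral_congr_ae (Eventually.of_forall fun t => ?_)
        simp only [mul_right_comm _ (φ t)]
        rw [integral_mul_const, ← mul_assoc, ← phaseCoeff, phaseCoeff_comp_sub hΨ.1]

theorem continuous_phaseCoeff {f : ℝ → ℝ} (hf : Integrable f symPeriodMeasure) (k : ℕ) :
    Continuous (phaseCoeff f k) := by
  simp only [funext (phaseCoeff_eq hf k)]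
  fun_prop

theorem integrable_phaseCoeff_mul {Ψ φ : ℝ → ℝ} (hΨ : Integrable Ψ symPeriodMeasure)
    (hφ : Integrable φ symPeriodMeasure) (k : ℕ) (c : ℝ) :
    Integrable (fun t : ℝ => phaseCoeff Ψ k (c - k * t) * φ t) symPeriodMeasure := by
  have hcont : Continuous fun t : ℝ => phaseCoeff Ψ k (c - k * t) :=
    (continuous_phaseCoeff hΨ k).comp (by fun_prop)
  rw [symPeriodMeasure, ← IntegrableOn, ← integrableOn_Icc_iff_integrableOn_Ioc] at hφ ⊢
  exact hφ.continuousOn_mul hcont.continuousOn isCompact_Icc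

theorem perConv_fourierSum {Ψ φ : ℝ → ℝ} (hΨ : MemPerLp 1 Ψ) (hφ : MemPerLp 1 φ) (m : ℕ) (x : ℝ) :
    perConv (fourierSum m Ψ) φ x = fourierSum m (perConv Ψ φ) x := by
  have hint := integrable_phaseCoeff_mul hΨ.integrable hφ.integrable
  have hint_zero := hφ.integrable.const_mul (phaseCoeff Ψ 0 0 / 2)
  rw [fourierSum_eq_sum_phaseCoeff (hΨ.perConv hφ).integrable, perConv_eq_integral]
  simp only [fourierSum_eq_sum_phaseCoeff hΨ.integrable, phaseCoeff_perConv hΨ hφ, mul_sub, add_mul,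
    Finset.sum_mul]
  rw [integral_add hint_zero (integrable_finsetSum _ fun k _ => hint k _),
    integral_finsetSum _ fun k _ => hint k _]
  simp only [Nat.cast_zero, zero_mul, sub_zero, integral_const_mul]
  ring

theorem perConv_sub_ae_eq {Ψ Λ φ : ℝ → ℝ} (hΨ : MemPerLp 1 Ψ) (hΛ : MemPerLp 1 Λ)
    (hφ : MemPerLp 1 φ) : perConv (fun u => Ψ u - Λ u) φ =ᵐ[symPeriodMeasure]
      fun x => perConv Ψ φ x - perConv Λ φ x := by
  filter_upwards [(integrable_comp_sub_mul hΨ hφ).prod_right_ae,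
    (integrable_comp_sub_mul hΛ hφ).prod_right_ae] with x hx_Ψ hx_Λ
  simp only [perConv_eq_integral, sub_mul]
  exact integral_sub hx_Ψ hx_Λ

theorem sub_fourierSum_ae_eq {Ψ φ f : ℝ → ℝ} {a₀ : ℝ} (hΨ : MemPerLp 1 Ψ) (hφ : MemPerLp 1 φ)
    (hf : f =ᵐ[symPeriodMeasure] fun x => a₀ / 2 + 1 / π * perConv Ψ φ x) (m : ℕ) :
    (fun x => f x - fourierSum m f x) =ᵐ[symPeriodMeasure]
      fun x => 1 / π * perConv (fun u => Ψ u - fourierSum m Ψ u) φ x := by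
  have hS := memPerLp_of_mem_trigPolys (fourierSum_mem_trigPolys m Ψ)
  filter_upwards [hf, perConv_sub_ae_eq hΨ hS hφ] with x hfx hsub
  rw [hfx, hsub, perConv_fourierSum hΨ hφ, fourierSum_congr_ae hf,
    fourierSum_const_add_const_mul (hΨ.perConv hφ).integrable]
  ring

theorem IsKernel.phaseCoeff_zero {ψ Ψ : ℝ → ℝ} {β : ℝ} (hΨ : IsKernel ψ β Ψ) (c : ℝ) :
    phaseCoeff Ψ 0 c = 0 := by
  simp [phaseCoeff_eq hΨ.1.integrable, hΨ.2.1, sinCoeff]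

theorem IsKernel.phaseCoeff_eq_mul_cos {ψ Ψ : ℝ → ℝ} {β : ℝ} (hΨ : IsKernel ψ β Ψ) {k : ℕ}
    (hk : 1 ≤ k) (c : ℝ) : phaseCoeff Ψ k c = ψ k * Real.cos (c - β * π / 2) := by
  rw [phaseCoeff_eq hΨ.1.integrable, (hΨ.2.2 k hk).1, (hΨ.2.2 k hk).2, Real.cos_sub]
  ring

theorem IsKernel.fourierSum_eq {ψ Ψ : ℝ → ℝ} {β : ℝ} (hΨ : IsKernel ψ β Ψ) (m : ℕ) :
    fourierSum m Ψ = cosPartialSum (fun k => ψ k) (β * π / 2) m := by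
  ext x
  rw [fourierSum_eq_sum_phaseCoeff hΨ.1.integrable, hΨ.phaseCoeff_zero, zero_div, zero_add]
  exact Finset.sum_congr rfl fun k hk => hΨ.phaseCoeff_eq_mul_cos (Finset.mem_Icc.1 hk).1 _

/-! ### Uniqueness of Fourier coefficients -/

section Uniqueness

variable {h : ℝ → ℝ}

theorem integral_mul_cos_int_mul_sub_eq_zero (hcoeff : ∀ k c, phaseCoeff h k c = 0) (n : ℤ)
    (c : ℝ) : ∫ x, h x * Real.cos (n * x - c) ∂symPeriodMeasure = 0 := by
  have hnat (k : ℕ) (c : ℝ) : ∫ x, h x * Real.cos (k * x - c) ∂symPeriodMeasure = 0 := by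
    simpa only [phaseCoeff, mul_eq_zero, one_div, inv_eq_zero, Real.pi_ne_zero, false_or]
      using hcoeff k c
  obtain ⟨k, rfl | rfl⟩ := n.eq_nat_or_neg
  · exact_mod_cast hnat k c
  · have hneg (x : ℝ) : ((-(k : ℤ) : ℤ) : ℝ) * x - c = -(k * x - -c) := by push_cast; ring
    simpa only [hneg, Real.cos_neg] using hnat k (-c)

theorem fourier_two_pi_apply (n : ℤ) (x : ℝ) : fourier n (x : AddCircle (2 * π)) =
    (Real.cos (n * x - 0) : ℂ) + (Real.cos (n * x - π / 2) : ℂ) * Complex.I := by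
  have hexp : 2 * (π : ℂ) * Complex.I * n * x / ((2 * π : ℝ) : ℂ) =
      ((n * x : ℝ) : ℂ) * Complex.I := by
    have hpi : (π : ℂ) ≠ 0 := by exact_mod_cast Real.pi_ne_zero
    push_cast
    field_simp
  rw [fourier_coe_apply, hexp, Complex.exp_mul_I, sub_zero, Real.cos_sub_pi_div_two,
    Complex.ofReal_cos, Complex.ofReal_sin]

theorem integral_mul_fourier_eq_zero (hint : Integrable h symPeriodMeasure)
    (hcoeff : ∀ k c, phaseCoeff h k c = 0) (n : ℤ) :
    ∫ x, (h x : ℂ) * fourier n (x : AddCircle (2 * π)) ∂symPeriodMeasure = 0 := by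
  have hcos (c : ℝ) : Integrable (fun x : ℝ => ((h x * Real.cos (n * x - c) : ℝ) : ℂ))
      symPeriodMeasure := (integrable_mul_cos_sub hint n c).ofReal
  simp only [fourier_two_pi_apply, mul_add, ← mul_assoc, ← Complex.ofReal_mul]
  rw [integral_add (hcos 0) ((hcos (π / 2)).mul_const _), integral_mul_const,
    integral_complex_ofReal, integral_complex_ofReal,
    integral_mul_cos_int_mul_sub_eq_zero hcoeff, integral_mul_cos_int_mul_sub_eq_zero hcoeff,
    Complex.ofReal_zero, zero_mul, add_zero]

theorem integrable_mul_continuousMap_addCircle [Fact (0 < 2 * π)]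
    (hint : Integrable h symPeriodMeasure) (F : C(AddCircle (2 * π), ℂ)) :
    Integrable (fun x : ℝ => (h x : ℂ) * F (x : AddCircle (2 * π))) symPeriodMeasure :=
  hint.ofReal.mul_bdd (c := ‖F‖)
    (F.continuous.comp (AddCircle.continuous_mk' (2 * π))).aestronglyMeasurable
    (Eventually.of_forall fun _ => F.norm_coe_le_norm _)

theorem integral_mul_continuousMap_eq_zero [Fact (0 < 2 * π)]
    (hint : Integrable h symPeriodMeasure) (hcoeff : ∀ k c, phaseCoeff h k c = 0)
    (F : C(AddCircle (2 * π), ℂ)) :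
    ∫ x, (h x : ℂ) * F (x : AddCircle (2 * π)) ∂symPeriodMeasure = 0 := by
  have hI := integrable_mul_continuousMap_addCircle hint
  let L₀ : C(AddCircle (2 * π), ℂ) →ₗ[ℂ] ℂ :=
    { toFun := fun F => ∫ x, (h x : ℂ) * F (x : AddCircle (2 * π)) ∂symPeriodMeasure
      map_add' := fun F G => by
        simp only [ContinuousMap.add_apply, mul_add, integral_add (hI F) (hI G)]
      map_smul' := fun c F => by
        simp only [ContinuousMap.smul_apply, smul_eq_mul, RingHom.id_apply, mul_left_comm,
          integral_const_mul] }
  let L : C(AddCircle (2 * π), ℂ) →L[ℂ] ℂ :=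
    L₀.mkContinuous (∫ x, ‖h x‖ ∂symPeriodMeasure) fun F => by
      refine (norm_integral_le_integral_norm _).trans ?_
      rw [← integral_mul_const]
      refine integral_mono (hI F).norm (hint.norm.mul_const _) fun x => ?_
      simp only [norm_mul, Complex.norm_real]
      gcongr
      exact F.norm_coe_le_norm _
  have hdense :
      Dense (Submodule.span ℂ (range (@fourier (2 * π))) : Set C(AddCircle (2 * π), ℂ)) :=
    Submodule.dense_iff_topologicalClosure_eq_top.2 span_fourier_closure_eq_top
  have hL : L = 0 := ContinuousLinearMap.ext_on hdense <| by
    rintro _ ⟨n, rfl⟩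
    exact integral_mul_fourier_eq_zero hint hcoeff n
  exact DFunLike.congr_fun hL F

theorem integral_mul_eq_zero_of_phaseCoeff_eq_zero (hint : Integrable h symPeriodMeasure)
    (hcoeff : ∀ k c, phaseCoeff h k c = 0) {g : ℝ → ℝ} (hg : Continuous g) (hg_eq : g (-π) = g π) :
    ∫ x, h x * g x ∂symPeriodMeasure = 0 := by
  have : Fact (0 < 2 * π) := ⟨Real.two_pi_pos⟩
  have hend : -π + 2 * π = π := by ring
  let F : C(AddCircle (2 * π), ℂ) :=
    ⟨AddCircle.liftIoc (2 * π) (-π) fun x => (g x : ℂ),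
      AddCircle.liftIoc_continuous (by simp only [hend, hg_eq])
        (Complex.continuous_ofReal.comp hg).continuousOn⟩
  have hF : ∀ x ∈ Ioc (-π) π, F (x : AddCircle (2 * π)) = g x := fun x hx =>
    AddCircle.liftIoc_coe_apply (f := fun x => (g x : ℂ)) (by rwa [hend])
  have hF_int := integral_mul_continuousMap_eq_zero hint hcoeff F
  rw [symPeriodMeasure, setIntegral_congr_fun (g := fun x => ((h x * g x : ℝ) : ℂ))
    measurableSet_Ioc fun x hx => by simp only [hF x hx, Complex.ofReal_mul],
    integral_complex_ofReal] at hF_int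
  exact_mod_cast hF_int

theorem ae_eq_zero_of_phaseCoeff_eq_zero (hint : Integrable h symPeriodMeasure)
    (hcoeff : ∀ k c, phaseCoeff h k c = 0) :
    h =ᵐ[symPeriodMeasure] 0 := by
  have hIoo : ∀ᵐ x : ℝ, x ∈ Ioo (-π) π → h x = 0 := by
    refine isOpen_Ioo.ae_eq_zero_of_integral_contDiff_smul_eq_zero
      (IntegrableOn.mono_set hint Ioo_subset_Ioc_self).locallyIntegrableOn fun g hg _ hg_supp => ?_
    have hg_zero : ∀ x ∉ Ioo (-π) π, g x = 0 := fun x hx =>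
      image_eq_zero_of_notMem_tsupport fun hx' => hx (hg_supp hx')
    rw [← integral_mul_eq_zero_of_phaseCoeff_eq_zero hint hcoeff hg.continuous
      (by rw [hg_zero _ (by simp), hg_zero _ (by simp)]), symPeriodMeasure,
      setIntegral_eq_integral_of_forall_compl_eq_zero fun x hx => by
        rw [hg_zero x fun hx' => hx (Ioo_subset_Ioc_self hx'), mul_zero]]
    simp only [smul_eq_mul, mul_comm]
  rw [symPeriodMeasure, ← restrict_Ioo_eq_restrict_Ioc]
  exact (ae_restrict_iff' measurableSet_Ioo).2 hIoo

end Uniqueness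

theorem ae_eq_of_phaseCoeff_eq {f g : ℝ → ℝ} (hf : Integrable f symPeriodMeasure)
    (hg : Integrable g symPeriodMeasure) (hfg : ∀ k c, phaseCoeff f k c = phaseCoeff g k c) :
    f =ᵐ[symPeriodMeasure] g := by
  have hsub : (fun t => f t - g t) =ᵐ[symPeriodMeasure] 0 :=
    ae_eq_zero_of_phaseCoeff_eq_zero (hf.sub hg) fun k c => by
      rw [phaseCoeff_sub hf hg, hfg, sub_self]
  filter_upwards [hsub] with x hx
  exact sub_eq_zero.1 hx

theorem IsKernel.ae_eq {ψ Ψ Λ : ℝ → ℝ} {β : ℝ} (hΨ : IsKernel ψ β Ψ) (hΛ : IsKernel ψ β Λ) :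
    Ψ =ᵐ[symPeriodMeasure] Λ :=
  ae_eq_of_phaseCoeff_eq hΨ.1.integrable hΛ.1.integrable fun k c => by
    rcases Nat.eq_zero_or_pos k with rfl | hk
    · rw [hΨ.phaseCoeff_zero, hΛ.phaseCoeff_zero]
    · rw [hΨ.phaseCoeff_eq_mul_cos hk, hΛ.phaseCoeff_eq_mul_cos hk]

/-! ### Cosine sums with almost decreasing coefficients -/

theorem abs_div_pi_le_abs_sin_half {x : ℝ} (hx : |x| ≤ π) : |x| / π ≤ |Real.sin (x / 2)| := by
  have hJordan := Real.mul_le_sin (x := |x| / 2) (by positivity) (by linarith)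
  have hsin_abs : |Real.sin (|x| / 2)| = |Real.sin (x / 2)| := by
    rcases abs_choice x with h | h <;> rw [h]
    rw [neg_div, Real.sin_neg, abs_neg]
  calc |x| / π = 2 / π * (|x| / 2) := by ring
    _ ≤ |Real.sin (x / 2)| := hsin_abs ▸ hJordan.trans (le_abs_self _)

theorem two_mul_sin_half_mul_sum_cos (x γ : ℝ) {a b : ℕ} (hab : a ≤ b) :
    2 * Real.sin (x / 2) * ∑ k ∈ Finset.Ico a b, Real.cos (k * x - γ) =
      Real.sin ((b - 1 / 2) * x - γ) - Real.sin ((a - 1 / 2) * x - γ) := by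
  induction b, hab using Nat.le_induction with
  | base => rw [Finset.Ico_self, Finset.sum_empty, mul_zero, sub_self]
  | succ b hab ih =>
    rw [Finset.sum_Ico_succ_top hab, mul_add, ih,
      show ((b + 1 : ℕ) - 1 / 2 : ℝ) * x - γ = (b * x - γ) + x / 2 by push_cast; ring,
      show ((b : ℝ) - 1 / 2) * x - γ = (b * x - γ) - x / 2 by ring, Real.sin_add, Real.sin_sub]
    ring

theorem abs_sum_cos_le {x : ℝ} (hx₀ : x ≠ 0) (hx : |x| ≤ π) (γ : ℝ) {a b : ℕ} (hab : a ≤ b) :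
    |∑ k ∈ Finset.Ico a b, Real.cos (k * x - γ)| ≤ π / |x| := by
  set S := |∑ k ∈ Finset.Ico a b, Real.cos (k * x - γ)|
  have hx_pos : 0 < |x| := abs_pos.2 hx₀
  have htelescope : 2 * |Real.sin (x / 2)| * S ≤ 2 := by
    rw [← abs_of_pos (zero_lt_two' ℝ), ← abs_mul, ← abs_mul, abs_of_pos (zero_lt_two' ℝ),
      two_mul_sin_half_mul_sum_cos x γ hab]
    refine (abs_sub _ _).trans ?_
    linarith [Real.abs_sin_le_one ((b - 1 / 2) * x - γ), Real.abs_sin_le_one ((a - 1 / 2) * x - γ)]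
  have hS : |x| / π * S ≤ 1 := by
    have := mul_le_mul_of_nonneg_right (abs_div_pi_le_abs_sin_half hx) (abs_nonneg _ : 0 ≤ S)
    linarith
  rw [div_mul_eq_mul_div, div_le_one Real.pi_pos] at hS
  rwa [le_div_iff₀ hx_pos, mul_comm]

theorem norm_sum_smul_le_of_antitone {E : Type*} [SeminormedAddCommGroup E] [NormedSpace ℝ E]
    {u : ℕ → ℝ} {c : ℕ → E} {M : ℝ} {a b : ℕ} (hab : a ≤ b) (hu : AntitoneOn u (Ici a))
    (hu₀ : ∀ k, a ≤ k → 0 ≤ u k) (hc : ∀ b, a ≤ b → ‖∑ k ∈ Finset.Ico a b, c k‖ ≤ M) :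
    ‖∑ k ∈ Finset.Ico a b, u k • c k‖ ≤ u a * M := by
  have hsum_sub : ‖∑ k ∈ Finset.Ico a b, u k • c k - u b • ∑ k ∈ Finset.Ico a b, c k‖ ≤
      (u a - u b) * M := by
    induction b, hab using Nat.le_induction with
    | base => simp
    | succ b hab ih =>
      have hstep : 0 ≤ u b - u (b + 1) := sub_nonneg.2 (hu hab (by grind) b.le_succ)
      calc ‖∑ k ∈ Finset.Ico a (b + 1), u k • c k - u (b + 1) • ∑ k ∈ Finset.Ico a (b + 1), c k‖
          = ‖(∑ k ∈ Finset.Ico a b, u k • c k - u b • ∑ k ∈ Finset.Ico a b, c k) +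
              (u b - u (b + 1)) • ∑ k ∈ Finset.Ico a (b + 1), c k‖ := by
            rw [Finset.sum_Ico_succ_top hab, Finset.sum_Ico_succ_top hab]
            congr 1
            module
        _ ≤ (u a - u b) * M + (u b - u (b + 1)) * M := by
            refine (norm_add_le _ _).trans (add_le_add ih ?_)
            rw [norm_smul, Real.norm_of_nonneg hstep]
            exact mul_le_mul_of_nonneg_left (hc _ (by omega)) hstep
        _ = (u a - u (b + 1)) * M := by ring
  have hlast : ‖u b • ∑ k ∈ Finset.Ico a b, c k‖ ≤ u b * M := by
    rw [norm_smul, Real.norm_of_nonneg (hu₀ b hab)]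
    exact mul_le_mul_of_nonneg_left (hc b hab) (hu₀ b hab)
  calc ‖∑ k ∈ Finset.Ico a b, u k • c k‖
      ≤ ‖∑ k ∈ Finset.Ico a b, u k • c k - u b • ∑ k ∈ Finset.Ico a b, c k‖ +
          ‖u b • ∑ k ∈ Finset.Ico a b, c k‖ := norm_le_norm_sub_add _ _
    _ ≤ (u a - u b) * M + u b * M := add_le_add hsum_sub hlast
    _ = u a * M := by ring

theorem sum_Ico_rpow_neg_le {α : ℝ} (hα₀ : 0 ≤ α) (hα₁ : α ≠ 1) {n N : ℕ} (hn : 1 ≤ n)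
    (hnN : n ≤ N) : ∑ k ∈ Finset.Ico n (N + 1), (k : ℝ) ^ (-α) ≤
      (1 + 1 / |1 - α|) * max ((n : ℝ) ^ (1 - α)) ((N : ℝ) ^ (1 - α)) := by
  have hn₀ : (0 : ℝ) < n := by exact_mod_cast hn
  have hanti : AntitoneOn (fun x : ℝ => x ^ (-α)) (Icc n N) := fun x hx y _ hxy =>
    Real.rpow_le_rpow_of_nonpos (hn₀.trans_le hx.1) hxy (by linarith)
  have hintegral : ∫ x in (n : ℝ)..N, x ^ (-α) =
      ((N : ℝ) ^ (1 - α) - (n : ℝ) ^ (1 - α)) / (1 - α) := by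
    rw [integral_rpow (Or.inr ⟨by simpa only [ne_eq, neg_inj] using hα₁, ?_⟩), neg_add_eq_sub]
    rw [uIcc_of_le (by exact_mod_cast hnN)]
    exact fun h => hn₀.not_ge h.1
  have hA : 0 ≤ (n : ℝ) ^ (1 - α) := by positivity
  have hB : 0 ≤ (N : ℝ) ^ (1 - α) := by positivity
  calc ∑ k ∈ Finset.Ico n (N + 1), (k : ℝ) ^ (-α)
      = (n : ℝ) ^ (-α) + ∑ k ∈ Finset.Ico n N, ((k + 1 : ℕ) : ℝ) ^ (-α) := by
        rw [Finset.sum_eq_sum_Ico_succ_bot (by omega),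
          Finset.sum_Ico_add' (fun k : ℕ => (k : ℝ) ^ (-α))]
    _ ≤ (n : ℝ) ^ (-α) + ((N : ℝ) ^ (1 - α) - (n : ℝ) ^ (1 - α)) / (1 - α) := by
        rw [← hintegral]
        gcongr
        exact hanti.sum_le_integral_Ico hnN
    _ ≤ (n : ℝ) ^ (1 - α) + max ((n : ℝ) ^ (1 - α)) ((N : ℝ) ^ (1 - α)) / |1 - α| := by
        refine add_le_add (Real.rpow_le_rpow_of_exponent_le (by exact_mod_cast hn) (by linarith))
          ((le_abs_self _).trans ?_)
        rw [abs_div]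
        gcongr
        exact abs_sub_le_iff.2 ⟨(sub_le_self _ hA).trans (le_max_right _ _),
          (sub_le_self _ hB).trans (le_max_left _ _)⟩
    _ ≤ _ := by
        rw [add_mul, one_mul, one_div_mul_eq_div]
        gcongr
        exact le_max_left _ _

/-- A positive nonincreasing sequence `u` on `{1, 2, …}` such that `k ^ α * u k` is almost
decreasing with constant `K`; this is the discrete form of membership in `Θ_q` with exponent
`α`. -/
structure IsAlmostDecreasing (u : ℕ → ℝ) (α K : ℝ) : Prop where
  antitoneOn : AntitoneOn u (Ici 1)
  pos : ∀ k, 1 ≤ k → 0 < u k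
  rpow_mul_le : ∀ m k : ℕ, 1 ≤ m → m ≤ k → (k : ℝ) ^ α * u k ≤ K * ((m : ℝ) ^ α * u m)

namespace IsAlmostDecreasing

variable {u : ℕ → ℝ} {α K : ℝ}

theorem one_le (h : IsAlmostDecreasing u α K) : 1 ≤ K := by
  have h_one := h.rpow_mul_le 1 1 le_rfl le_rfl
  have hu := h.pos 1 le_rfl
  rw [Nat.cast_one, Real.one_rpow, one_mul] at h_one
  exact le_of_mul_le_mul_right (by linarith) hu

theorem mono (h : IsAlmostDecreasing u α K) {α' : ℝ} (hα : α' ≤ α) :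
    IsAlmostDecreasing u α' K where
  antitoneOn := h.antitoneOn
  pos := h.pos
  rpow_mul_le m k hm hk := by
    have hm₀ : (0 : ℝ) < m := by exact_mod_cast hm
    have hk₀ : (0 : ℝ) < k := by exact_mod_cast hm.trans hk
    have hsplit {x : ℝ} (hx : 0 < x) : x ^ α' = x ^ (α' - α) * x ^ α := by
      rw [← Real.rpow_add hx, sub_add_cancel]
    have hu := h.pos k (hm.trans hk)
    calc (k : ℝ) ^ α' * u k = (k : ℝ) ^ (α' - α) * ((k : ℝ) ^ α * u k) := by
          rw [hsplit hk₀, mul_assoc]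
      _ ≤ (m : ℝ) ^ (α' - α) * (K * ((m : ℝ) ^ α * u m)) := by
          refine mul_le_mul ?_ (h.rpow_mul_le m k hm hk) (by positivity) (by positivity)
          exact Real.rpow_le_rpow_of_nonpos hm₀ (by exact_mod_cast hk) (by linarith)
      _ = K * ((m : ℝ) ^ α' * u m) := by rw [hsplit hm₀]; ring

theorem le_rpow (h : IsAlmostDecreasing u α K) {m k : ℕ} (hm : 1 ≤ m) (hk : m ≤ k) :
    u k ≤ K * u m * (m : ℝ) ^ α * (k : ℝ) ^ (-α) := by
  have hk₀ : (0 : ℝ) < k := by exact_mod_cast hm.trans hk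
  rw [Real.rpow_neg hk₀.le, ← div_eq_mul_inv, le_div_iff₀ (Real.rpow_pos_of_pos hk₀ _)]
  linarith [h.rpow_mul_le m k hm hk]

theorem sum_Ico_le (h : IsAlmostDecreasing u α K) (hα₀ : 0 ≤ α) (hα₁ : α ≠ 1) {n N : ℕ}
    (hn : 1 ≤ n) (hnN : n ≤ N) : ∑ k ∈ Finset.Ico n (N + 1), u k ≤
      K * (1 + 1 / |1 - α|) * (u n * ((n : ℝ) ^ min α 1 * (N : ℝ) ^ (1 - min α 1))) := by
  have hn₀ : (0 : ℝ) < n := by exact_mod_cast hn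
  have hnN' : (n : ℝ) ≤ N := by exact_mod_cast hnN
  have hc : 0 ≤ K * u n * (n : ℝ) ^ α := by
    have := h.one_le
    have := h.pos n hn
    positivity
  have hmax : (n : ℝ) ^ α * max ((n : ℝ) ^ (1 - α)) ((N : ℝ) ^ (1 - α)) =
      (n : ℝ) ^ min α 1 * (N : ℝ) ^ (1 - min α 1) := by
    rcases le_total α 1 with hα | hα
    · rw [min_eq_left hα, max_eq_right (Real.rpow_le_rpow hn₀.le hnN' (by linarith))]
    · rw [min_eq_right hα, max_eq_left (Real.rpow_le_rpow_of_nonpos hn₀ hnN' (by linarith)),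
        ← Real.rpow_add hn₀, add_sub_cancel, sub_self, Real.rpow_zero, mul_one]
  calc ∑ k ∈ Finset.Ico n (N + 1), u k
      ≤ ∑ k ∈ Finset.Ico n (N + 1), K * u n * (n : ℝ) ^ α * (k : ℝ) ^ (-α) :=
        Finset.sum_le_sum fun k hk => h.le_rpow hn (Finset.mem_Ico.1 hk).1
    _ = K * u n * (n : ℝ) ^ α * ∑ k ∈ Finset.Ico n (N + 1), (k : ℝ) ^ (-α) := by
        rw [Finset.mul_sum]
    _ ≤ K * u n * (n : ℝ) ^ α *
          ((1 + 1 / |1 - α|) * max ((n : ℝ) ^ (1 - α)) ((N : ℝ) ^ (1 - α))) := by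
        gcongr
        exact sum_Ico_rpow_neg_le hα₀ hα₁ hn hnN
    _ = _ := by rw [← hmax]; ring

theorem abs_sum_mul_cos_le_sum (h : IsAlmostDecreasing u α K) {n b N : ℕ} (hn : 1 ≤ n)
    (hb : b ≤ N) (x γ : ℝ) :
    |∑ k ∈ Finset.Ico n b, u k * Real.cos (k * x - γ)| ≤ ∑ k ∈ Finset.Ico n N, u k := by
  have hpos {k : ℕ} {m : ℕ} (hk : k ∈ Finset.Ico n m) : 0 ≤ u k :=
    (h.pos k (hn.trans (Finset.mem_Ico.1 hk).1)).le
  calc |∑ k ∈ Finset.Ico n b, u k * Real.cos (k * x - γ)|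
      ≤ ∑ k ∈ Finset.Ico n b, u k := by
        refine (Finset.abs_sum_le_sum_abs _ _).trans (Finset.sum_le_sum fun k hk => ?_)
        rw [abs_mul, abs_of_nonneg (hpos hk)]
        exact mul_le_of_le_one_right (hpos hk) (Real.abs_cos_le_one _)
    _ ≤ ∑ k ∈ Finset.Ico n N, u k :=
        Finset.sum_le_sum_of_subset_of_nonneg (Finset.Ico_subset_Ico_right hb)
          fun k hk _ => hpos hk

theorem abs_sum_mul_cos_le_pi_div (h : IsAlmostDecreasing u α K) {n b : ℕ} (hn : 1 ≤ n)
    (hb : n ≤ b) {x : ℝ} (hx₀ : x ≠ 0) (hx : |x| ≤ π) (γ : ℝ) :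
    |∑ k ∈ Finset.Ico n b, u k * Real.cos (k * x - γ)| ≤ u n * (π / |x|) :=
  norm_sum_smul_le_of_antitone (c := fun k => Real.cos (k * x - γ)) hb
    (h.antitoneOn.mono (Ici_subset_Ici.2 hn))
    (fun k hk => (h.pos k (hn.trans hk)).le) fun _ hb' => abs_sum_cos_le hx₀ hx γ hb'

end IsAlmostDecreasing

/-- The profile of the remainder of a cosine series with coefficients decreasing like `k ^ (-α)`: at
`x`, the remainder starting with index `n` is bounded by a multiple of `u n * n` times the value of
the profile at `n x`. -/
noncomputable def remainderProfile (α y : ℝ) : ℝ :=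
  if |y| ≤ 1 then |y| ^ (min α 1 - 1) else |y|⁻¹

theorem remainderProfile_nonneg (α y : ℝ) : 0 ≤ remainderProfile α y := by
  unfold remainderProfile
  split_ifs <;> positivity

namespace IsAlmostDecreasing

variable {u : ℕ → ℝ} {α K : ℝ}

theorem abs_sum_mul_cos_le_sum_add (h : IsAlmostDecreasing u α K) {n b N : ℕ} (hn : 1 ≤ n)
    (hnN : n ≤ N) {x : ℝ} (hx₀ : x ≠ 0) (hx : |x| ≤ π) (γ : ℝ) :
    |∑ k ∈ Finset.Ico n b, u k * Real.cos (k * x - γ)| ≤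
      ∑ k ∈ Finset.Ico n N, u k + u N * (π / |x|) := by
  rcases le_total b N with hbN | hNb
  · have := h.pos N (hn.trans hnN)
    exact (h.abs_sum_mul_cos_le_sum hn hbN x γ).trans (le_add_of_nonneg_right (by positivity))
  · rw [← Finset.sum_Ico_consecutive _ hnN hNb]
    exact (abs_add_le _ _).trans (add_le_add (h.abs_sum_mul_cos_le_sum hn le_rfl x γ)
      (h.abs_sum_mul_cos_le_pi_div (hn.trans hnN) hNb hx₀ hx γ))

theorem abs_sum_mul_cos_le_of_le_one (h : IsAlmostDecreasing u α K) (hα₀ : 0 ≤ α) (hα₁ : α ≠ 1)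
    {n b : ℕ} (hn : 1 ≤ n) {x : ℝ} (hx₀ : x ≠ 0) (hx : |x| ≤ π) (hnx : n * |x| ≤ 1)
    (γ : ℝ) : |∑ k ∈ Finset.Ico n b, u k * Real.cos (k * x - γ)| ≤
      K * (1 + 1 / |1 - α| + π) * (u n * ((n : ℝ) ^ min α 1 * |x| ^ (min α 1 - 1))) := by
  set σ := min α 1
  have hσ : σ ≤ 1 := min_le_right _ _
  have hσ₀ : 0 ≤ σ := le_min hα₀ zero_le_one
  have hx_pos : 0 < |x| := abs_pos.2 hx₀
  have hK := h.one_le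
  have hu := h.pos n hn
  -- Up to `N ≈ 1 / |x|` the cosines are bounded by `1`; beyond `N` they oscillate.
  set N := ⌊|x|⁻¹⌋₊
  have hN_le : (N : ℝ) ≤ |x|⁻¹ := Nat.floor_le (by positivity)
  have hN_lt : |x|⁻¹ < (N + 1 : ℕ) := by exact_mod_cast Nat.lt_floor_add_one _
  have hnN : n ≤ N := Nat.le_floor (by rwa [← one_div, le_div_iff₀ hx_pos])
  have hN_rpow : (N : ℝ) ^ (1 - σ) ≤ |x| ^ (σ - 1) := by
    rw [← neg_sub 1 σ, Real.rpow_neg hx_pos.le, ← Real.inv_rpow hx_pos.le]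
    exact Real.rpow_le_rpow N.cast_nonneg hN_le (by linarith)
  have hN_succ_rpow : ((N + 1 : ℕ) : ℝ) ^ (-σ) ≤ |x| ^ σ := by
    rw [← inv_inv (|x| ^ σ), ← Real.inv_rpow hx_pos.le, ← Real.rpow_neg (by positivity)]
    exact Real.rpow_le_rpow_of_nonpos (by positivity) hN_lt.le (by linarith)
  calc |∑ k ∈ Finset.Ico n b, u k * Real.cos (k * x - γ)|
      ≤ ∑ k ∈ Finset.Ico n (N + 1), u k + u (N + 1) * (π / |x|) :=
        h.abs_sum_mul_cos_le_sum_add hn (by omega) hx₀ hx γ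
    _ ≤ K * (1 + 1 / |1 - α|) * (u n * ((n : ℝ) ^ σ * (N : ℝ) ^ (1 - σ))) +
          K * u n * (n : ℝ) ^ σ * ((N + 1 : ℕ) : ℝ) ^ (-σ) * (π / |x|) := by
        gcongr
        · exact h.sum_Ico_le hα₀ hα₁ hn hnN
        · exact (h.mono (min_le_left α 1)).le_rpow hn (by omega)
    _ ≤ K * (1 + 1 / |1 - α|) * (u n * ((n : ℝ) ^ σ * |x| ^ (σ - 1))) +
          K * u n * (n : ℝ) ^ σ * |x| ^ σ * (π / |x|) := by gcongr
    _ = K * (1 + 1 / |1 - α| + π) * (u n * ((n : ℝ) ^ σ * |x| ^ (σ - 1))) := by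
        rw [Real.rpow_sub_one hx_pos.ne']
        ring

theorem abs_sum_mul_cos_le (h : IsAlmostDecreasing u α K) (hα₀ : 0 ≤ α) (hα₁ : α ≠ 1) {n b : ℕ}
    (hn : 1 ≤ n) (hb : n ≤ b) {x : ℝ} (hx₀ : x ≠ 0) (hx : |x| ≤ π) (γ : ℝ) :
    |∑ k ∈ Finset.Ico n b, u k * Real.cos (k * x - γ)| ≤
      K * (1 + 1 / |1 - α| + π) * (u n * n) * remainderProfile α (n * x) := by
  have hx_pos : 0 < |x| := abs_pos.2 hx₀
  have hn₀ : (0 : ℝ) < n := by exact_mod_cast hn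
  have hu := h.pos n hn
  have habs : |n * x| = n * |x| := by rw [abs_mul, abs_of_pos hn₀]
  rw [remainderProfile, habs]
  split_ifs with hnx
  · refine (h.abs_sum_mul_cos_le_of_le_one hα₀ hα₁ hn hx₀ hx hnx γ).trans_eq ?_
    rw [Real.mul_rpow hn₀.le hx_pos.le, Real.rpow_sub_one hn₀.ne']
    field_simp
  · have hconst : π ≤ K * (1 + 1 / |1 - α| + π) :=
      calc π ≤ 1 * (1 + 1 / |1 - α| + π) := by
            have : 0 ≤ 1 / |1 - α| := by positivity
            linarith
        _ ≤ _ := mul_le_mul_of_nonneg_right h.one_le (by positivity)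
    calc |∑ k ∈ Finset.Ico n b, u k * Real.cos (k * x - γ)|
        ≤ u n * (π / |x|) := h.abs_sum_mul_cos_le_pi_div hn hb hx₀ hx γ
      _ = π * (u n * n) * (n * |x|)⁻¹ := by field_simp
      _ ≤ _ := by gcongr

end IsAlmostDecreasing

theorem integrable_of_even {E : Type*} [NormedAddCommGroup E] {f : ℝ → E} (hf : Function.Even f)
    (hint : IntegrableOn f (Ioi 0)) : Integrable f := by
  have hIio : IntegrableOn f (Iio 0) := by
    have hcomp := ((Measure.measurePreserving_neg (volume : Measure ℝ)).integrableOn_comp_preimage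
      (Homeomorph.neg ℝ).measurableEmbedding).2 hint
    rw [show (Neg.neg : ℝ → ℝ) ⁻¹' Ioi 0 = Iio 0 by ext x; simp] at hcomp
    exact hcomp.congr_fun (fun x _ => hf x) measurableSet_Iio
  rw [← integrableOn_univ, ← Iic_union_Ioi (a := (0 : ℝ))]
  exact ((integrableOn_Iic_iff_integrableOn_Iio ..).2 hIio).union hint

section RemainderProfile

variable {α : ℝ}

theorem measurable_remainderProfile (α : ℝ) : Measurable (remainderProfile α) := by
  unfold remainderProfile
  refine Measurable.ite (measurableSet_le (by fun_prop) (by fun_prop)) ?_ ?_ <;> fun_prop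

theorem integrable_remainderProfile_rpow {q : ℝ} (hq : 1 < q) (hα : 1 < α + q⁻¹) :
    Integrable fun y => remainderProfile α y ^ q := by
  have hq₀ : 0 < q := by linarith
  refine integrable_of_even (fun y => by simp only [remainderProfile, abs_neg]) ?_
  rw [← Ioc_union_Ioi_eq_Ioi zero_le_one]
  refine IntegrableOn.union ?_ ?_
  · have hexponent : -1 < (min α 1 - 1) * q := by
      rw [← div_lt_iff₀ hq₀, neg_div, one_div, lt_sub_iff_add_lt', lt_min_iff]
      exact ⟨by linarith, by linarith [inv_pos.2 hq₀]⟩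
    have hint := (intervalIntegrable_iff_integrableOn_Ioc_of_le zero_le_one).1
      (intervalIntegral.intervalIntegrable_rpow' (a := 0) (b := 1) hexponent)
    refine hint.congr_fun (fun y hy => ?_) measurableSet_Ioc
    simp only [remainderProfile, abs_of_pos hy.1, if_pos hy.2, Real.rpow_mul hy.1.le]
  · have hint := integrableOn_Ioi_rpow_of_lt (a := -q) (by linarith) zero_lt_one
    refine hint.congr_fun (fun y (hy : 1 < y) => ?_) measurableSet_Ioi
    have hy₀ : 0 < y := zero_lt_one.trans hy
    simp only [remainderProfile, abs_of_pos hy₀, if_neg (not_le.2 hy), Real.inv_rpow hy₀.le,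
      Real.rpow_neg hy₀.le]

theorem remainderProfile_le_one (hα : 1 ≤ α) (y : ℝ) : remainderProfile α y ≤ 1 := by
  rw [remainderProfile, min_eq_right hα, sub_self, Real.rpow_zero]
  split_ifs with hy
  · exact le_rfl
  · exact inv_le_one_of_one_le₀ (not_le.1 hy).le

theorem memLp_remainderProfile {p : ℝ≥0∞} (hp : 1 < p) (hα : 1 < α + p.toReal⁻¹) :
    MemLp (remainderProfile α) p := by
  have hmeas := (measurable_remainderProfile α).aestronglyMeasurable (μ := volume)
  rcases eq_or_ne p ∞ with rfl | hp_top
  · rw [ENNReal.toReal_top, inv_zero, add_zero] at hα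
    refine memLp_top_of_bound hmeas 1 (Eventually.of_forall fun y => ?_)
    rw [Real.norm_of_nonneg (remainderProfile_nonneg α y)]
    exact remainderProfile_le_one hα.le y
  · have hq : 1 < p.toReal := by
      rwa [← ENNReal.toReal_one, ENNReal.toReal_lt_toReal ENNReal.one_ne_top hp_top]
    rw [← integrable_norm_rpow_iff hmeas (zero_lt_one.trans hp).ne' hp_top]
    simpa only [Real.norm_of_nonneg (remainderProfile_nonneg α _)] using
      integrable_remainderProfile_rpow hq hα

theorem integrable_remainderProfile (hα : 0 < α) :
    Integrable (remainderProfile α) symPeriodMeasure := by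
  obtain ⟨q, hq, hqα⟩ : ∃ q : ℝ, 1 < q ∧ 1 < α + q⁻¹ := by
    have hnear : ∀ᶠ q : ℝ in 𝓝[>] 1, 1 < α + q⁻¹ := by
      refine (Tendsto.eventually_const_lt (v := α + 1) (by linarith) ?_).filter_mono
        nhdsWithin_le_nhds
      simpa only [inv_one] using
        ((continuousAt_inv₀ (one_ne_zero' ℝ)).tendsto.const_add α)
    obtain ⟨q, hqα, hq⟩ := (hnear.and self_mem_nhdsWithin).exists
    exact ⟨q, hq, hqα⟩
  have hmem : MemLp (remainderProfile α) (ENNReal.ofReal q) :=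
    memLp_remainderProfile (ENNReal.one_lt_ofReal.2 hq)
      (by rwa [ENNReal.toReal_ofReal (by linarith)])
  exact ((hmem.mono_measure Measure.restrict_le_self).mono_exponent
    (ENNReal.one_le_ofReal.2 hq.le)).integrable le_rfl

end RemainderProfile

/-! ### The kernel as a convergent series -/

/-- The pointwise sum of the series `∑_{k ≥ 1} u k cos(k x - γ)`; it is a junk value at the points
where the series diverges, which for the coefficients considered here can only be the multiples of
`2π`. -/
noncomputable def cosSeries (u : ℕ → ℝ) (γ x : ℝ) : ℝ :=
  limUnder atTop fun N => cosPartialSum u γ N x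

theorem cosSeries_periodic (u : ℕ → ℝ) (γ : ℝ) : Function.Periodic (cosSeries u γ) (2 * π) :=
  fun x => by simp only [cosSeries, cosPartialSum_periodic u γ _ x]

theorem cosPartialSum_sub_cosPartialSum (u : ℕ → ℝ) (γ x : ℝ) {n N : ℕ} (hn : 1 ≤ n)
    (hN : n ≤ N + 1) : cosPartialSum u γ N x - cosPartialSum u γ (n - 1) x =
      ∑ k ∈ Finset.Ico n (N + 1), u k * Real.cos (k * x - γ) := by
  have hIco (M : ℕ) : cosPartialSum u γ M x =
      ∑ k ∈ Finset.Ico 1 (M + 1), u k * Real.cos (k * x - γ) := rfl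
  rw [hIco, hIco, Nat.sub_add_cancel hn, ← Finset.sum_Ico_consecutive _ hn hN, add_sub_cancel_left]

theorem ae_symPeriodMeasure_ne_zero_and_abs_le : ∀ᵐ x ∂symPeriodMeasure, x ≠ 0 ∧ |x| ≤ π := by
  filter_upwards [ae_restrict_of_ae (Measure.ae_ne volume (0 : ℝ)),
    ae_restrict_mem measurableSet_Ioc] with x hx₀ hx
  exact ⟨hx₀, abs_le.2 ⟨hx.1.le, hx.2⟩⟩

namespace IsAlmostDecreasing

variable {u : ℕ → ℝ} {α K : ℝ}

theorem tendsto_zero (h : IsAlmostDecreasing u α K) (hα : 0 < α) : Tendsto u atTop (𝓝 0) := by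
  have hbound :
      Tendsto (fun k : ℕ => K * u 1 * ((1 : ℕ) : ℝ) ^ α * (k : ℝ) ^ (-α)) atTop (𝓝 0) := by
    simpa only [mul_zero] using!
      ((tendsto_rpow_neg_atTop hα).comp tendsto_natCast_atTop_atTop).const_mul
        (K * u 1 * ((1 : ℕ) : ℝ) ^ α)
  refine tendsto_of_tendsto_of_tendsto_of_le_of_le' tendsto_const_nhds hbound ?_ ?_
  · filter_upwards [eventually_ge_atTop 1] with k hk using (h.pos k hk).le
  · filter_upwards [eventually_ge_atTop 1] with k hk using h.le_rpow le_rfl hk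

theorem tendsto_cosPartialSum (h : IsAlmostDecreasing u α K) (hα : 0 < α) {x : ℝ} (hx₀ : x ≠ 0)
    (hx : |x| ≤ π) (γ : ℝ) :
    Tendsto (fun N => cosPartialSum u γ N x) atTop (𝓝 (cosSeries u γ x)) := by
  refine CauchySeq.tendsto_limUnder (cauchySeq_of_le_tendsto_0'
    (fun N => u (N + 1) * (π / |x|)) (fun N M hNM => ?_) ?_)
  · rw [dist_comm, Real.dist_eq]
    have hsub := cosPartialSum_sub_cosPartialSum u γ x (n := N + 1) (N := M) (by omega) (by omega)
    rw [Nat.add_sub_cancel] at hsub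
    rw [hsub]
    exact h.abs_sum_mul_cos_le_pi_div (by omega) (by omega) hx₀ hx γ
  · simpa only [zero_mul] using!
      ((h.tendsto_zero hα).comp (tendsto_add_atTop_nat 1)).mul_const (π / |x|)

theorem abs_cosPartialSum_le (h : IsAlmostDecreasing u α K) (hα₀ : 0 ≤ α) (hα₁ : α ≠ 1) {x : ℝ}
    (hx₀ : x ≠ 0) (hx : |x| ≤ π) (γ : ℝ) (N : ℕ) :
    |cosPartialSum u γ N x| ≤ K * (1 + 1 / |1 - α| + π) * u 1 * remainderProfile α x := by
  simpa only [Nat.cast_one, mul_one, one_mul] using!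
    h.abs_sum_mul_cos_le hα₀ hα₁ le_rfl (show 1 ≤ N + 1 by omega) hx₀ hx γ

theorem abs_cosSeries_sub_cosPartialSum_le (h : IsAlmostDecreasing u α K) (hα₀ : 0 < α)
    (hα₁ : α ≠ 1) {n : ℕ} (hn : 1 ≤ n) {x : ℝ} (hx₀ : x ≠ 0) (hx : |x| ≤ π) (γ : ℝ) :
    |cosSeries u γ x - cosPartialSum u γ (n - 1) x| ≤
      K * (1 + 1 / |1 - α| + π) * (u n * n) * remainderProfile α (n * x) := by
  refine le_of_tendsto
    ((h.tendsto_cosPartialSum hα₀ hx₀ hx γ).sub_const (cosPartialSum u γ (n - 1) x)).abs ?_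
  filter_upwards [eventually_ge_atTop n] with N hN
  rw [cosPartialSum_sub_cosPartialSum u γ x hn (by omega)]
  exact h.abs_sum_mul_cos_le hα₀.le hα₁ hn (by omega) hx₀ hx γ

theorem aestronglyMeasurable_cosSeries (h : IsAlmostDecreasing u α K) (hα : 0 < α) (γ : ℝ) :
    AEStronglyMeasurable (cosSeries u γ) symPeriodMeasure :=
  aestronglyMeasurable_of_tendsto_ae atTop
    (fun N => (continuous_cosPartialSum u γ N).aestronglyMeasurable)
    (ae_symPeriodMeasure_ne_zero_and_abs_le.mono fun _ hx =>
      h.tendsto_cosPartialSum hα hx.1 hx.2 γ)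

theorem memPerLp_cosSeries (h : IsAlmostDecreasing u α K) (hα₀ : 0 < α) (hα₁ : α ≠ 1) (γ : ℝ) :
    MemPerLp 1 (cosSeries u γ) := by
  refine memPerLp_one_of_integrable (cosSeries_periodic u γ)
    (((integrable_remainderProfile hα₀).const_mul (K * (1 + 1 / |1 - α| + π) * u 1)).mono'
      (h.aestronglyMeasurable_cosSeries hα₀ γ) ?_)
  filter_upwards [ae_symPeriodMeasure_ne_zero_and_abs_le] with x ⟨hx₀, hx⟩
  exact le_of_tendsto (h.tendsto_cosPartialSum hα₀ hx₀ hx γ).abs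
    (Eventually.of_forall fun N => h.abs_cosPartialSum_le hα₀.le hα₁ hx₀ hx γ N)

theorem phaseCoeff_cosSeries (h : IsAlmostDecreasing u α K) (hα₀ : 0 < α) (hα₁ : α ≠ 1) (γ : ℝ)
    (k : ℕ) (c : ℝ) :
    phaseCoeff (cosSeries u γ) k c = if 1 ≤ k then u k * Real.cos (c - γ) else 0 := by
  have hlim : Tendsto (fun N => phaseCoeff (cosPartialSum u γ N) k c) atTop
      (𝓝 (phaseCoeff (cosSeries u γ) k c)) := by
    refine Tendsto.const_mul _ (tendsto_integral_of_dominated_convergence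
      (fun x => K * (1 + 1 / |1 - α| + π) * u 1 * remainderProfile α x) (fun N => ?_)
      ((integrable_remainderProfile hα₀).const_mul _) (fun N => ?_) ?_)
    · have hcont := continuous_cosPartialSum u γ N
      exact Continuous.aestronglyMeasurable (by fun_prop)
    · filter_upwards [ae_symPeriodMeasure_ne_zero_and_abs_le] with x ⟨hx₀, hx⟩
      rw [norm_mul]
      exact (mul_le_of_le_one_right (norm_nonneg _) (Real.abs_cos_le_one _)).trans
        (h.abs_cosPartialSum_le hα₀.le hα₁ hx₀ hx γ N)
    · filter_upwards [ae_symPeriodMeasure_ne_zero_and_abs_le] with x ⟨hx₀, hx⟩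
      exact (h.tendsto_cosPartialSum hα₀ hx₀ hx γ).mul_const _
  refine tendsto_nhds_unique hlim (tendsto_const_nhds.congr' ?_)
  filter_upwards [eventually_ge_atTop k] with N hN
  simp only [phaseCoeff_cosPartialSum, Finset.mem_Icc, hN, and_true]

theorem isKernel_cosSeries {ψ : ℝ → ℝ} (h : IsAlmostDecreasing (fun k => ψ k) α K) (hα₀ : 0 < α)
    (hα₁ : α ≠ 1) (β : ℝ) : IsKernel ψ β (cosSeries (fun k => ψ k) (β * π / 2)) := by
  refine ⟨h.memPerLp_cosSeries hα₀ hα₁ _, ?_, fun k hk => ⟨?_, ?_⟩⟩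
  · rw [← phaseCoeff_zero_right, h.phaseCoeff_cosSeries hα₀ hα₁, if_neg (by omega)]
  · rw [← phaseCoeff_zero_right, h.phaseCoeff_cosSeries hα₀ hα₁, if_pos hk, zero_sub, Real.cos_neg]
  · rw [← phaseCoeff_pi_div_two, h.phaseCoeff_cosSeries hα₀ hα₁, if_pos hk, Real.cos_pi_div_two_sub]

end IsAlmostDecreasing

/-! ### The upper bound -/

theorem eLpNorm_comp_mul_left (H : ℝ → ℝ) (p : ℝ≥0∞) {a : ℝ} (ha : 0 < a) :
    eLpNorm (fun x => H (a * x)) p = ENNReal.ofReal (a ^ (-p.toReal⁻¹)) * eLpNorm H p := by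
  have hmap : eLpNorm H p (Measure.map (fun x => a * x) volume) =
      eLpNorm (fun x => H (a * x)) p :=
    (Homeomorph.mulLeft₀ a ha.ne').measurableEmbedding.eLpNorm_map_measure
  rw [← hmap, Real.map_volume_mul_left ha.ne', abs_of_pos (inv_pos.2 ha),
    eLpNorm_smul_measure_of_ne_zero (by positivity), smul_eq_mul,
    ENNReal.ofReal_rpow_of_pos (inv_pos.2 ha), Real.inv_rpow ha.le, Real.rpow_neg ha.le,
    one_div, ENNReal.toReal_inv]

theorem eLpNorm_const_mul_comp_mul_left (H : ℝ → ℝ) (p : ℝ≥0∞) {b a : ℝ} (hb : 0 ≤ b)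
    (ha : 0 < a) :
    eLpNorm (fun x => b * H (a * x)) p = ENNReal.ofReal (b * a ^ (-p.toReal⁻¹)) * eLpNorm H p := by
  have hsmul := eLpNorm_const_smul b (fun x => H (a * x)) p volume
  rw [Real.enorm_of_nonneg hb, eLpNorm_comp_mul_left H p ha, ← mul_assoc,
    ← ENNReal.ofReal_mul hb] at hsmul
  exact hsmul

theorem IsAlmostDecreasing.norm_sub_fourierSum_le {ψ Ψ : ℝ → ℝ} {α K β : ℝ}
    (h : IsAlmostDecreasing (fun k => ψ k) α K) (hα₀ : 0 < α) (hα₁ : α ≠ 1)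
    (hΨ : IsKernel ψ β Ψ) {n : ℕ} (hn : 1 ≤ n) : ∀ᵐ x ∂symPeriodMeasure,
      ‖Ψ x - fourierSum (n - 1) Ψ x‖ ≤
        ‖K * (1 + 1 / |1 - α| + π) * (ψ n * n) * remainderProfile α (n * x)‖ := by
  filter_upwards [hΨ.ae_eq (h.isKernel_cosSeries hα₀ hα₁ β),
    ae_symPeriodMeasure_ne_zero_and_abs_le] with x hΨx ⟨hx₀, hx⟩
  rw [hΨx, hΨ.fourierSum_eq]
  exact (h.abs_cosSeries_sub_cosPartialSum_le hα₀ hα₁ hn hx₀ hx _).trans (le_abs_self _)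

theorem IsAlmostDecreasing.perNorm_sub_fourierSum_le {ψ Ψ : ℝ → ℝ} {α K β : ℝ}
    (h : IsAlmostDecreasing (fun k => ψ k) α K) (hα₀ : 0 < α) (hα₁ : α ≠ 1) (p : ℝ≥0∞)
    (hΨ : IsKernel ψ β Ψ) {n : ℕ} (hn : 1 ≤ n) :
    perNorm p (fun x => Ψ x - fourierSum (n - 1) Ψ x) ≤
      ENNReal.ofReal (K * (1 + 1 / |1 - α| + π) * (ψ n * (n : ℝ) ^ (1 - p.toReal⁻¹))) *
        eLpNorm (remainderProfile α) p := by
  have hn₀ : (0 : ℝ) < n := by exact_mod_cast hn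
  have hpow : (n : ℝ) ^ (1 - p.toReal⁻¹) = n * (n : ℝ) ^ (-p.toReal⁻¹) := by
    rw [sub_eq_add_neg, Real.rpow_add hn₀, Real.rpow_one]
  set b := K * (1 + 1 / |1 - α| + π) * (ψ n * n) with hb
  have hb₀ : 0 ≤ b := by
    have hψ : 0 < ψ n := h.pos n hn
    have hK := h.one_le
    positivity
  have hper : Function.Periodic (fun x => Ψ x - fourierSum (n - 1) Ψ x) (2 * π) :=
    hΨ.1.1.sub (memPerLp_of_mem_trigPolys (fourierSum_mem_trigPolys (n - 1) Ψ)).1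
  rw [perNorm_eq_eLpNorm_symPeriodMeasure hper p]
  refine (eLpNorm_mono_ae (h.norm_sub_fourierSum_le hα₀ hα₁ hΨ hn)).trans ?_
  refine (eLpNorm_mono_measure _ Measure.restrict_le_self).trans_eq ?_
  rw [eLpNorm_const_mul_comp_mul_left _ p hb₀ hn₀, hpow, hb,
    mul_assoc _ (ψ n * (n : ℝ)), mul_assoc (ψ n)]

theorem fourierDeviation_le {ψ : ℝ → ℝ} {β : ℝ} {n : ℕ} {p : ℝ≥0∞} (hp : 1 ≤ p) {M : ℝ≥0∞}
    (hM : ∀ Ψ, IsKernel ψ β Ψ → perNorm p (fun x => Ψ x - fourierSum (n - 1) Ψ x) ≤ M) :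
    fourierDeviation n (psiClass ψ β 1) p ≤ M := by
  refine iSup₂_le ?_
  rintro f ⟨hf_per, Ψ, a₀, φ, hΨ, hφ, hφ_norm, -, hf⟩
  have hS {g : ℝ → ℝ} := memPerLp_of_mem_trigPolys (fourierSum_mem_trigPolys (n - 1) g)
  have hR : MemPerLp 1 fun u => Ψ u - fourierSum (n - 1) Ψ u := ⟨hΨ.1.1.sub hS.1, hΨ.1.2.sub hS.2⟩
  calc perNorm p (fun x => f x - fourierSum (n - 1) f x)
      = eLpNorm (fun x => 1 / π * perConv (fun u => Ψ u - fourierSum (n - 1) Ψ u) φ x) p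
          symPeriodMeasure := by
        refine (perNorm_eq_eLpNorm_symPeriodMeasure (hf_per.sub hS.1) p).trans ?_
        exact eLpNorm_congr_ae (sub_fourierSum_ae_eq hΨ.1 hφ (ae_restrict_of_ae hf) (n - 1))
    _ ≤ eLpNorm (perConv (fun u => Ψ u - fourierSum (n - 1) Ψ u) φ) p symPeriodMeasure := by
        refine eLpNorm_mono fun x => ?_
        rw [norm_mul, Real.norm_of_nonneg (by positivity)]
        refine mul_le_of_le_one_left (norm_nonneg _) ?_
        exact (div_le_one Real.pi_pos).2 (by linarith [Real.pi_gt_three])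
    _ = perNorm p (perConv (fun u => Ψ u - fourierSum (n - 1) Ψ u) φ) :=
        (perNorm_eq_eLpNorm_symPeriodMeasure (perConv_periodic hR.1 φ) p).symm
    _ ≤ perNorm p (fun u => Ψ u - fourierSum (n - 1) Ψ u) * perNorm 1 φ :=
        perNorm_perConv_le hR hφ hp
    _ ≤ M * 1 := by gcongr; exact hM Ψ hΨ
    _ = M := mul_one M

theorem bestApprox_le_fourierDeviation (n : ℕ) (N : Set (ℝ → ℝ)) (p : ℝ≥0∞) :
    bestApprox n N p ≤ fourierDeviation n N p :=
  iSup₂_mono fun f _ => iInf₂_le _ (fourierSum_mem_trigPolys (n - 1) f)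

theorem inv_toReal_le_one {p : ℝ≥0∞} (hp : 1 ≤ p) : p.toReal⁻¹ ≤ 1 := by
  rw [← ENNReal.toReal_inv, ← ENNReal.toReal_one]
  exact ENNReal.toReal_mono ENNReal.one_ne_top (ENNReal.inv_le_one.2 hp)

theorem IsAlmostDecreasing.exists_fourierDeviation_le {ψ : ℝ → ℝ} {α K : ℝ}
    (h : IsAlmostDecreasing (fun k => ψ k) α K) (hα₁ : α ≠ 1) {p : ℝ≥0∞} (hp : 1 < p)
    (hα : 1 < α + p.toReal⁻¹) : ∃ C : ℝ, 0 < C ∧ ∀ (β : ℝ) (n : ℕ), 1 ≤ n →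
      fourierDeviation n (psiClass ψ β 1) p ≤
        ENNReal.ofReal (C * ψ n * (n : ℝ) ^ (1 - p.toReal⁻¹)) := by
  have hα₀ : 0 < α := by linarith [inv_toReal_le_one hp.le]
  have hprofile := (memLp_remainderProfile hp hα).eLpNorm_ne_top
  have hK := h.one_le
  set A := (eLpNorm (remainderProfile α) p).toReal with hA
  refine ⟨K * (1 + 1 / |1 - α| + π) * (A + 1), by positivity,
    fun β n hn => fourierDeviation_le hp.le fun Ψ hΨ => ?_⟩
  have hψ : 0 < ψ n := h.pos n hn
  refine (h.perNorm_sub_fourierSum_le hα₀ hα₁ p hΨ hn).trans ?_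
  rw [← ENNReal.ofReal_toReal hprofile, ← hA, ← ENNReal.ofReal_mul (by positivity)]
  refine ENNReal.ofReal_le_ofReal ?_
  calc K * (1 + 1 / |1 - α| + π) * (ψ n * (n : ℝ) ^ (1 - p.toReal⁻¹)) * A
      = K * (1 + 1 / |1 - α| + π) * A * ψ n * (n : ℝ) ^ (1 - p.toReal⁻¹) := by ring
    _ ≤ _ := by
        gcongr
        exact le_add_of_nonneg_right zero_le_one

/-! ### Fejér kernels -/

theorem sq_sum_cos_add_sq_sum_sin (N : ℕ) (x : ℝ) :
    (∑ i ∈ Finset.range N, Real.cos (i * x)) ^ 2 + (∑ i ∈ Finset.range N, Real.sin (i * x)) ^ 2 =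
      N + ∑ k ∈ Finset.Icc 1 N, 2 * ((N : ℝ) - k) * Real.cos (k * x) := by
  induction N with
  | zero => simp
  | succ N ih =>
    set C := ∑ i ∈ Finset.range N, Real.cos (i * x) with hC
    set S := ∑ i ∈ Finset.range N, Real.sin (i * x) with hS
    have hcross : C * Real.cos (N * x) + S * Real.sin (N * x) =
        ∑ k ∈ Finset.Icc 1 N, Real.cos (k * x) := by
      rw [hC, hS, Finset.sum_mul, Finset.sum_mul, ← Finset.sum_add_distrib,
        ← Finset.sum_range_reflect, ← Finset.Ico_add_one_right_eq_Icc, Finset.sum_Ico_eq_sum_range]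
      refine Finset.sum_congr rfl fun i hi => ?_
      have hi' : i + 1 ≤ N := Finset.mem_range.1 hi
      rw [← Real.cos_sub, ← sub_mul, ← Real.cos_neg, show N - 1 - i = N - (i + 1) by omega,
        Nat.cast_sub hi']
      push_cast
      ring_nf
    have hsum : ∑ k ∈ Finset.Icc 1 (N + 1), 2 * (((N + 1 : ℕ) : ℝ) - k) * Real.cos (k * x) =
        ∑ k ∈ Finset.Icc 1 N, 2 * ((N : ℝ) - k) * Real.cos (k * x) +
          2 * ∑ k ∈ Finset.Icc 1 N, Real.cos (k * x) := by
      rw [Finset.sum_Icc_succ_top (by omega), sub_self, mul_zero, zero_mul, add_zero,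
        Finset.mul_sum, ← Finset.sum_add_distrib]
      refine Finset.sum_congr rfl fun k _ => ?_
      push_cast
      ring
    rw [Finset.sum_range_succ, Finset.sum_range_succ, hsum, ← hcross]
    push_cast
    linear_combination ih + Real.cos_sq_add_sin_sq (N * x)

/-- The coefficient of `cos (k x)` in the Fejér kernel of order `N - 1`. -/
noncomputable def fejerWeight (N k : ℕ) : ℝ := 2 * (1 - k / N)

/-- The Fejér kernel of order `N - 1`, normalized to have mean value one. The term `k = N` of its
defining sum vanishes; it is kept so that the range of summation has no truncated subtraction. -/
noncomputable def fejerKernel (N : ℕ) (x : ℝ) : ℝ := 1 + cosPartialSum (fejerWeight N) 0 N x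

theorem nat_mul_fejerKernel (N : ℕ) (x : ℝ) : N * fejerKernel N x =
    (∑ i ∈ Finset.range N, Real.cos (i * x)) ^ 2 +
      (∑ i ∈ Finset.range N, Real.sin (i * x)) ^ 2 := by
  rw [sq_sum_cos_add_sq_sum_sin, fejerKernel, cosPartialSum, mul_add, mul_one, Finset.mul_sum]
  congr 1
  refine Finset.sum_congr rfl fun k hk => ?_
  have hN : (N : ℝ) ≠ 0 := by
    have := Finset.mem_Icc.1 hk
    exact_mod_cast (show N ≠ 0 by omega)
  rw [fejerWeight, sub_zero]
  field_simp

theorem fejerWeight_nonneg {N k : ℕ} (hk : k ≤ N) : 0 ≤ fejerWeight N k := by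
  have : (k : ℝ) / N ≤ 1 := div_le_one_of_le₀ (by exact_mod_cast hk) N.cast_nonneg
  rw [fejerWeight]
  linarith

theorem fejerKernel_nonneg {N : ℕ} (hN : 0 < N) (x : ℝ) : 0 ≤ fejerKernel N x := by
  have h : 0 ≤ N * fejerKernel N x := by
    rw [nat_mul_fejerKernel]
    positivity
  exact nonneg_of_mul_nonneg_right h (by exact_mod_cast hN)

theorem one_add_sum_fejerWeight {N : ℕ} (hN : 0 < N) :
    1 + ∑ k ∈ Finset.Icc 1 N, fejerWeight N k = N := by
  have hN₀ : (N : ℝ) ≠ 0 := by exact_mod_cast hN.ne'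
  have h := nat_mul_fejerKernel N 0
  simp only [fejerKernel, cosPartialSum, mul_zero, sub_zero, Real.cos_zero, Real.sin_zero, mul_one,
    Finset.sum_const, Finset.card_range, nsmul_eq_mul] at h
  exact mul_left_cancel₀ hN₀ (by linarith)

theorem fejerKernel_le {N : ℕ} (hN : 0 < N) (x : ℝ) : fejerKernel N x ≤ N := by
  rw [← one_add_sum_fejerWeight hN, fejerKernel, cosPartialSum]
  gcongr with k hk
  exact mul_le_of_le_one_right (fejerWeight_nonneg (Finset.mem_Icc.1 hk).2) (Real.cos_le_one _)

theorem integral_cosPartialSum (u : ℕ → ℝ) (γ : ℝ) (N : ℕ) :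
    ∫ x, cosPartialSum u γ N x ∂symPeriodMeasure = 0 := by
  have h := phaseCoeff_cosPartialSum u γ N 0 0
  simpa [phaseCoeff, Real.pi_ne_zero] using h

theorem continuous_fejerKernel (N : ℕ) : Continuous (fejerKernel N) :=
  continuous_const.add (continuous_cosPartialSum _ _ _)

theorem integral_fejerKernel (N : ℕ) : ∫ x, fejerKernel N x ∂symPeriodMeasure = 2 * π := by
  simp only [fejerKernel]
  rw [integral_add (integrable_const 1) (memPerLp_cosPartialSum _ _ _).integrable,
    integral_cosPartialSum, integral_const_symPeriodMeasure, mul_one, add_zero]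

theorem eLpNorm_one_fejerKernel {N : ℕ} (hN : 0 < N) :
    eLpNorm (fejerKernel N) 1 symPeriodMeasure = ENNReal.ofReal (2 * π) := by
  have hint : Integrable (fejerKernel N) symPeriodMeasure :=
    (integrable_const 1).add (memPerLp_cosPartialSum _ _ _).integrable
  rw [eLpNorm_one_eq_lintegral_enorm, ← integral_fejerKernel N,
    ofReal_integral_eq_lintegral_ofReal hint (Eventually.of_forall (fejerKernel_nonneg hN))]
  exact lintegral_congr fun x => Real.enorm_of_nonneg (fejerKernel_nonneg hN x)

theorem eLpNorm_le_rpow_mul_eLpNorm_one_rpow {X E : Type*} [MeasurableSpace X] {μ : Measure X}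
    [NormedAddCommGroup E] {f : X → E} {M : NNReal} (hM : ∀ᵐ x ∂μ, ‖f x‖ₑ ≤ M) {q : ℝ≥0∞}
    (hq : 1 ≤ q) :
    eLpNorm f q μ ≤ (M : ℝ≥0∞) ^ (1 - q.toReal⁻¹) * eLpNorm f 1 μ ^ q.toReal⁻¹ := by
  rcases eq_or_ne q ∞ with rfl | hq_top
  · simpa [eLpNormEssSup] using essSup_le_of_ae_le _ hM
  have hq₁ : 1 ≤ q.toReal := ENNReal.toReal_one ▸ ENNReal.toReal_mono hq_top hq
  have hq₀ : 0 < q.toReal := zero_lt_one.trans_le hq₁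
  have hpow : ∀ᵐ x ∂μ, ‖f x‖ₑ ^ q.toReal ≤ (M : ℝ≥0∞) ^ (q.toReal - 1) * ‖f x‖ₑ := by
    filter_upwards [hM] with x hx
    calc ‖f x‖ₑ ^ q.toReal = ‖f x‖ₑ ^ (q.toReal - 1) * ‖f x‖ₑ := by
          conv_rhs => rw [← ENNReal.rpow_one ‖f x‖ₑ, ← ENNReal.rpow_mul, one_mul]
          rw [← ENNReal.rpow_add_of_nonneg _ _ (by linarith) zero_le_one, sub_add_cancel]
      _ ≤ (M : ℝ≥0∞) ^ (q.toReal - 1) * ‖f x‖ₑ := by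
          gcongr
  rw [eLpNorm_eq_lintegral_rpow_enorm_toReal (zero_lt_one.trans_le hq).ne' hq_top, one_div,
    eLpNorm_one_eq_lintegral_enorm]
  calc (∫⁻ x, ‖f x‖ₑ ^ q.toReal ∂μ) ^ q.toReal⁻¹
      ≤ ((M : ℝ≥0∞) ^ (q.toReal - 1) * ∫⁻ x, ‖f x‖ₑ ∂μ) ^ q.toReal⁻¹ := by
        rw [← lintegral_const_mul' _ _
          (ENNReal.rpow_ne_top_of_nonneg (by linarith) ENNReal.coe_ne_top)]
        exact ENNReal.rpow_le_rpow (lintegral_mono_ae hpow) (inv_nonneg.2 hq₀.le)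
    _ = (M : ℝ≥0∞) ^ (1 - q.toReal⁻¹) * (∫⁻ x, ‖f x‖ₑ ∂μ) ^ q.toReal⁻¹ := by
        rw [ENNReal.mul_rpow_of_nonneg _ _ (inv_nonneg.2 hq₀.le), ← ENNReal.rpow_mul, sub_mul,
          mul_inv_cancel₀ hq₀.ne', one_mul]

theorem eLpNorm_fejerKernel_le {N : ℕ} (hN : 0 < N) {q : ℝ≥0∞} (hq : 1 ≤ q) :
    eLpNorm (fejerKernel N) q symPeriodMeasure ≤
      ENNReal.ofReal (2 * π * (N : ℝ) ^ (1 - q.toReal⁻¹)) := by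
  have hN₀ : (0 : ℝ) < N := by exact_mod_cast hN
  have hbound (x : ℝ) : ‖fejerKernel N x‖ₑ ≤ ((N : NNReal) : ℝ≥0∞) := by
    rw [Real.enorm_of_nonneg (fejerKernel_nonneg hN x), ENNReal.coe_natCast,
      ← ENNReal.ofReal_natCast]
    exact ENNReal.ofReal_le_ofReal (fejerKernel_le hN x)
  have hpi : 1 ≤ ENNReal.ofReal (2 * π) := by
    rw [ENNReal.one_le_ofReal]
    linarith [Real.pi_gt_three]
  calc eLpNorm (fejerKernel N) q symPeriodMeasure
      ≤ ((N : NNReal) : ℝ≥0∞) ^ (1 - q.toReal⁻¹) * ENNReal.ofReal (2 * π) ^ q.toReal⁻¹ := by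
        rw [← eLpNorm_one_fejerKernel hN]
        exact eLpNorm_le_rpow_mul_eLpNorm_one_rpow (Eventually.of_forall hbound) hq
    _ ≤ ENNReal.ofReal ((N : ℝ) ^ (1 - q.toReal⁻¹)) * ENNReal.ofReal (2 * π) := by
        rw [← ENNReal.ofReal_rpow_of_pos hN₀, ENNReal.ofReal_natCast, ENNReal.coe_natCast]
        gcongr
        exact (ENNReal.rpow_le_rpow_of_exponent_le hpi (inv_toReal_le_one hq)).trans_eq
          (ENNReal.rpow_one _)
    _ = ENNReal.ofReal (2 * π * (N : ℝ) ^ (1 - q.toReal⁻¹)) := by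
        rw [mul_comm, ENNReal.ofReal_mul Real.two_pi_pos.le]

/-! ### The lower bound -/

theorem fejerKernel_mul_cos {N m : ℕ} (hNm : N ≤ m) (γ x : ℝ) :
    fejerKernel N x * Real.cos (m * x - γ) = Real.cos (m * x - γ) +
      ∑ k ∈ Finset.Icc 1 N, fejerWeight N k / 2 *
        (Real.cos ((m + k : ℕ) * x - γ) + Real.cos ((m - k : ℕ) * x - γ)) := by
  rw [fejerKernel, cosPartialSum, add_mul, one_mul, Finset.sum_mul]
  congr 1
  refine Finset.sum_congr rfl fun k hk => ?_
  rw [Nat.cast_sub ((Finset.mem_Icc.1 hk).2.trans hNm), Nat.cast_add, sub_zero,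
    show ((m : ℝ) + k) * x - γ = (m * x - γ) + k * x by ring,
    show ((m : ℝ) - k) * x - γ = (m * x - γ) - k * x by ring, Real.cos_add (m * x - γ),
    Real.cos_sub (m * x - γ)]
  ring

theorem integral_mul_fejerKernel_mul_cos {f : ℝ → ℝ} (hf : Integrable f symPeriodMeasure)
    {N m : ℕ} (hNm : N ≤ m) (γ : ℝ) :
    ∫ x, f x * (fejerKernel N x * Real.cos (m * x - γ)) ∂symPeriodMeasure =
      π * (phaseCoeff f m γ + ∑ k ∈ Finset.Icc 1 N,
        fejerWeight N k / 2 * (phaseCoeff f (m + k) γ + phaseCoeff f (m - k) γ)) := by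
  have hint (j : ℕ) := integrable_mul_cos_sub hf j γ
  simp only [fejerKernel_mul_cos hNm, mul_add, Finset.mul_sum, pi_mul_phaseCoeff,
    mul_left_comm _ (_ / (2 : ℝ))]
  have hterm (k : ℕ) : Integrable (fun x =>
      fejerWeight N k / 2 * (f x * Real.cos ((m + k : ℕ) * x - γ)) +
        fejerWeight N k / 2 * (f x * Real.cos ((m - k : ℕ) * x - γ))) symPeriodMeasure :=
    ((hint (m + k)).const_mul (fejerWeight N k / 2)).add
    ((hint (m - k)).const_mul (fejerWeight N k / 2))
  rw [integral_add (hint m) (integrable_finsetSum _ fun k _ => hterm k),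
    integral_finsetSum _ fun k _ => hterm k]
  congr 1
  refine Finset.sum_congr rfl fun k _ => ?_
  rw [integral_add ((hint _).const_mul _) ((hint _).const_mul _), integral_const_mul,
    integral_const_mul]

theorem le_integral_mul_fejerKernel_mul_cos {f : ℝ → ℝ} (hf : Integrable f symPeriodMeasure)
    {N m : ℕ} (hN : 0 < N) (hNm : N ≤ m) {γ a : ℝ}
    (ha : ∀ k, m - N ≤ k → k ≤ m + N → a ≤ phaseCoeff f k γ) :
    π * (N * a) ≤ ∫ x, f x * (fejerKernel N x * Real.cos (m * x - γ)) ∂symPeriodMeasure := by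
  rw [integral_mul_fejerKernel_mul_cos hf hNm, ← one_add_sum_fejerWeight hN, add_mul, one_mul,
    Finset.sum_mul]
  refine mul_le_mul_of_nonneg_left (add_le_add (ha m (by omega) (by omega))
    (Finset.sum_le_sum fun k hk => ?_)) Real.pi_pos.le
  have hkN := (Finset.mem_Icc.1 hk).2
  have hw : 0 ≤ fejerWeight N k / 2 := by linarith [fejerWeight_nonneg hkN]
  calc fejerWeight N k * a = fejerWeight N k / 2 * (a + a) := by ring
    _ ≤ fejerWeight N k / 2 * (phaseCoeff f (m + k) γ + phaseCoeff f (m - k) γ) := by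
      gcongr <;> exact ha _ (by omega) (by omega)

theorem ofReal_integral_mul_le {X : Type*} [MeasurableSpace X] {μ : Measure X} {f g : X → ℝ}
    (hf : AEStronglyMeasurable f μ) (hg : AEStronglyMeasurable g μ) (p q : ℝ≥0∞)
    [p.HolderConjugate q] :
    ENNReal.ofReal (∫ x, f x * g x ∂μ) ≤ eLpNorm f p μ * eLpNorm g q μ :=
  calc ENNReal.ofReal (∫ x, f x * g x ∂μ) ≤ ‖∫ x, f x * g x ∂μ‖ₑ := by
        rw [Real.enorm_eq_ofReal_abs]
        exact ENNReal.ofReal_le_ofReal (le_abs_self _)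
    _ ≤ eLpNorm (f • g) 1 μ := by
        rw [eLpNorm_one_eq_lintegral_enorm]
        exact enorm_integral_le_lintegral_enorm _
    _ ≤ eLpNorm f p μ * eLpNorm g q μ := eLpNorm_smul_le_mul_eLpNorm hg hf

/-- The Fejér kernel modulated to frequency `m` is a test function of small dual norm that sees all
frequencies within distance `N` of `m`. -/
theorem le_perNorm_of_le_phaseCoeff {f : ℝ → ℝ} (hf : MemPerLp 1 f) {N m : ℕ} (hN : 0 < N)
    (hNm : N ≤ m) {γ a : ℝ} (ha : ∀ k, m - N ≤ k → k ≤ m + N → a ≤ phaseCoeff f k γ) {p : ℝ≥0∞}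
    (hp : 1 ≤ p) :
    ENNReal.ofReal (a / 2 * (N : ℝ) ^ (1 - p.toReal⁻¹)) ≤ perNorm p f := by
  have hN₀ : (0 : ℝ) < N := by exact_mod_cast hN
  have hpq := ENNReal.HolderConjugate.conjExponent hp
  set q := p.conjExponent
  have hexp : 1 - q.toReal⁻¹ = p.toReal⁻¹ := by
    have h := congrArg ENNReal.toReal (ENNReal.HolderConjugate.inv_add_inv_eq_one p q)
    rw [ENNReal.toReal_add (by simpa using hpq.ne_zero) (by simpa using hpq.symm.ne_zero)] at h
    simp only [ENNReal.toReal_inv, ENNReal.toReal_one] at h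
    linarith
  set g : ℝ → ℝ := fun x => fejerKernel N x * Real.cos (m * x - γ)
  have hg_cont : Continuous g := (continuous_fejerKernel N).mul (by fun_prop)
  have hg : eLpNorm g q symPeriodMeasure ≤ ENNReal.ofReal (2 * π * (N : ℝ) ^ p.toReal⁻¹) := by
    rw [← hexp]
    refine (eLpNorm_mono fun x => ?_).trans (eLpNorm_fejerKernel_le hN hpq.symm.one_le)
    rw [norm_mul]
    exact mul_le_of_le_one_right (norm_nonneg _) (Real.abs_cos_le_one _)
  have hB : 0 < 2 * π * (N : ℝ) ^ p.toReal⁻¹ := by positivity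
  have hchain : ENNReal.ofReal (π * (N * a)) ≤
      perNorm p f * ENNReal.ofReal (2 * π * (N : ℝ) ^ p.toReal⁻¹) :=
    calc ENNReal.ofReal (π * (N * a)) ≤ ENNReal.ofReal (∫ x, f x * g x ∂symPeriodMeasure) :=
          ENNReal.ofReal_le_ofReal
            (le_integral_mul_fejerKernel_mul_cos hf.integrable hN hNm ha)
      _ ≤ eLpNorm f p symPeriodMeasure * eLpNorm g q symPeriodMeasure :=
          ofReal_integral_mul_le hf.integrable.aestronglyMeasurable hg_cont.aestronglyMeasurable p q
      _ ≤ perNorm p f * ENNReal.ofReal (2 * π * (N : ℝ) ^ p.toReal⁻¹) := by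
          rw [perNorm_eq_eLpNorm_symPeriodMeasure hf.1]
          gcongr
  have hsplit : a / 2 * (N : ℝ) ^ (1 - p.toReal⁻¹) =
      π * (N * a) / (2 * π * (N : ℝ) ^ p.toReal⁻¹) := by
    rw [Real.rpow_sub hN₀, Real.rpow_one]
    field_simp
  rw [hsplit, ENNReal.ofReal_div_of_pos hB]
  exact ENNReal.div_le_of_le_mul hchain

/-- The Fejér kernel of order `2 m - 1` without its constant term, scaled into the unit ball of
`L₁`: a function `φ ⊥ 1` with `‖φ‖₁ ≤ 1` whose first `m` cosine coefficients are bounded below. -/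
noncomputable def fejerTest (m : ℕ) (x : ℝ) : ℝ :=
  1 / (4 * π) * cosPartialSum (fejerWeight (2 * m)) 0 (2 * m) x

theorem memPerLp_fejerTest (m : ℕ) : MemPerLp 1 (fejerTest m) :=
  memPerLp_one_of_continuous
    (fun x => congrArg (1 / (4 * π) * ·) (cosPartialSum_periodic _ 0 (2 * m) x))
    (continuous_const.mul (continuous_cosPartialSum _ _ _))

theorem integral_fejerTest (m : ℕ) : ∫ t in (-π)..π, fejerTest m t = 0 := by
  simp only [intervalIntegral_eq_integral_symPeriodMeasure, fejerTest]
  rw [integral_const_mul, integral_cosPartialSum, mul_zero]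

theorem perNorm_fejerTest_le {m : ℕ} (hm : 0 < m) : perNorm 1 (fejerTest m) ≤ 1 := by
  have hone : eLpNorm (fun _ => (1 : ℝ)) 1 symPeriodMeasure = ENNReal.ofReal (2 * π) := by
    rw [symPeriodMeasure, eLpNorm_const' _ one_ne_zero ENNReal.one_ne_top]
    simp [two_mul]
  have hsub : fejerTest m = (1 / (4 * π)) • (fejerKernel (2 * m) - fun _ => (1 : ℝ)) := by
    ext x
    simp [fejerTest, fejerKernel]
  rw [perNorm_eq_eLpNorm_symPeriodMeasure (memPerLp_fejerTest m).1, hsub, eLpNorm_const_smul,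
    Real.enorm_of_nonneg (by positivity)]
  calc ENNReal.ofReal (1 / (4 * π)) *
        eLpNorm (fejerKernel (2 * m) - fun _ => (1 : ℝ)) 1 symPeriodMeasure
      ≤ ENNReal.ofReal (1 / (4 * π)) * (ENNReal.ofReal (2 * π) + ENNReal.ofReal (2 * π)) := by
        gcongr
        refine (eLpNorm_sub_le (continuous_fejerKernel _).aestronglyMeasurable
          aestronglyMeasurable_const le_rfl).trans_eq ?_
        rw [eLpNorm_one_fejerKernel (by omega), hone]
    _ = 1 := by
        rw [← ENNReal.ofReal_add (by positivity) (by positivity),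
          ← ENNReal.ofReal_mul (by positivity), ENNReal.ofReal_eq_one]
        field_simp
        norm_num

theorem le_cosCoeff_fejerTest {m k : ℕ} (hk : 1 ≤ k) (hkm : k ≤ m) :
    1 / (4 * π) ≤ cosCoeff (fejerTest m) k := by
  have hweight : 1 ≤ fejerWeight (2 * m) k := by
    have hm : (0 : ℝ) < m := by exact_mod_cast hk.trans hkm
    have hdiv : (k : ℝ) / (2 * m) ≤ 1 / 2 := by
      rw [div_le_div_iff₀ (by positivity) two_pos]
      linarith [show (k : ℝ) ≤ m by exact_mod_cast hkm]
    rw [fejerWeight, Nat.cast_mul, Nat.cast_ofNat]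
    linarith
  have hcoeff : cosCoeff (fejerTest m) k = 1 / (4 * π) * fejerWeight (2 * m) k := by
    simp only [← phaseCoeff_zero_right, funext (fejerTest.eq_1 m)]
    rw [phaseCoeff_const_mul, phaseCoeff_cosPartialSum,
      if_pos (Finset.mem_Icc.2 ⟨hk, by omega⟩), sub_zero, Real.cos_zero, mul_one]
  rw [hcoeff]
  exact le_mul_of_one_le_right (by positivity) hweight

theorem IsKernel.phaseCoeff_perConv {ψ Ψ φ : ℝ → ℝ} {β : ℝ} (hΨ : IsKernel ψ β Ψ)
    (hφ : MemPerLp 1 φ) {k : ℕ} (hk : 1 ≤ k) :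
    phaseCoeff (perConv Ψ φ) k (β * π / 2) = π * (ψ k * cosCoeff φ k) := by
  rw [_root_.phaseCoeff_perConv hΨ.1 hφ, mul_left_comm, ← phaseCoeff_zero_right,
    pi_mul_phaseCoeff, ← integral_const_mul]
  refine integral_congr_ae (Eventually.of_forall fun t => ?_)
  simp only [hΨ.phaseCoeff_eq_mul_cos hk, sub_sub_cancel_left, Real.cos_neg, sub_zero]
  ring

theorem le_bestApprox {ψ Ψ : ℝ → ℝ} {β : ℝ} (hΨ : IsKernel ψ β Ψ) {n : ℕ} (hn : 1 ≤ n) {a : ℝ}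
    (ha : 0 ≤ a) (hψ : ∀ k : ℕ, n ≤ k → k ≤ 3 * n → a ≤ ψ k) {p : ℝ≥0∞} (hp : 1 ≤ p) :
    ENNReal.ofReal (a / (8 * π) * (n : ℝ) ^ (1 - p.toReal⁻¹)) ≤
      bestApprox n (psiClass ψ β 1) p := by
  have hφ := memPerLp_fejerTest (3 * n)
  set f : ℝ → ℝ := fun x => 1 / π * perConv Ψ (fejerTest (3 * n)) x
  have hf_per : Function.Periodic f (2 * π) := fun x =>
    congrArg (1 / π * ·) (perConv_periodic hΨ.1.1 _ x)
  have hf_int : Integrable f symPeriodMeasure := (hΨ.1.perConv hφ).integrable.const_mul _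
  have hf_mem : f ∈ psiClass ψ β 1 :=
    ⟨hf_per, Ψ, 0, fejerTest (3 * n), hΨ, hφ, perNorm_fejerTest_le (by omega),
      integral_fejerTest _, Eventually.of_forall fun x => by simp only [f, perConv]; ring⟩
  have hf_coeff : ∀ k : ℕ, n ≤ k → k ≤ 3 * n → a / (4 * π) ≤ phaseCoeff f k (β * π / 2) :=
    fun k hnk hkn =>
    calc a / (4 * π) = a * (1 / (4 * π)) := by ring
      _ ≤ ψ k * cosCoeff (fejerTest (3 * n)) k :=
        mul_le_mul (hψ k hnk hkn) (le_cosCoeff_fejerTest (by omega) hkn) (by positivity)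
          (ha.trans (hψ k hnk hkn))
      _ = phaseCoeff f k (β * π / 2) := by
        rw [phaseCoeff_const_mul, hΨ.phaseCoeff_perConv hφ (by omega)]
        field_simp
  refine le_iSup₂_of_le f hf_mem (le_iInf₂ fun t ht => ?_)
  have ht_mem := memPerLp_of_mem_trigPolys ht
  have hd : MemPerLp 1 fun x => f x - t x :=
    memPerLp_one_of_integrable (hf_per.sub ht_mem.1) (hf_int.sub ht_mem.integrable)
  have hlower := le_perNorm_of_le_phaseCoeff hd hn (m := 2 * n) (by omega) (γ := β * π / 2)
    (a := a / (4 * π)) (fun k hnk hkn => ?_) hp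
  · rwa [div_div, show 4 * π * 2 = 8 * π by ring] at hlower
  · rw [phaseCoeff_sub hf_int ht_mem.integrable, phaseCoeff_eq_zero_of_mem_trigPolys ht (by omega),
      sub_zero]
    exact hf_coeff k (by omega) (by omega)

/-! ### The classes `B` and `Θ_q` -/

theorem exists_isAlmostDecreasing {ψ : ℝ → ℝ} {q : ℝ} (hB : ψ ∈ classB) (hΘ : ψ ∈ classTheta q) :
    ∃ α K : ℝ, 1 / q < α ∧ α ≠ 1 ∧ IsAlmostDecreasing (fun k => ψ k) α K := by
  obtain ⟨hanti, hpos, -⟩ := hB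
  obtain ⟨-, α, hα, K, -, hK⟩ := hΘ
  have hone {k : ℕ} (hk : 1 ≤ k) : (1 : ℝ) ≤ k := by exact_mod_cast hk
  have h : IsAlmostDecreasing (fun k => ψ k) α (max K 1) :=
    { antitoneOn := fun m hm k hk hmk => hanti (hone hm) (hone hk) (by exact_mod_cast hmk)
      pos := fun k hk => hpos k (hone hk)
      rpow_mul_le := fun m k hm hmk => by
        have hnonneg : 0 ≤ (m : ℝ) ^ α * ψ m := mul_nonneg (by positivity) (hpos m (hone hm)).le
        rcases hmk.eq_or_lt with rfl | hlt
        · exact le_mul_of_one_le_left hnonneg (le_max_right _ _)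
        · exact (hK k m (hone hm) (by exact_mod_cast hlt)).trans
            (mul_le_mul_of_nonneg_right (le_max_left _ _) hnonneg) }
  rcases eq_or_ne α 1 with rfl | hα₁
  · obtain ⟨α', hα', hα'₁⟩ := exists_between hα
    exact ⟨α', max K 1, hα', hα'₁.ne, h.mono hα'₁.le⟩
  · exact ⟨α, max K 1, hα, hα₁, h⟩

theorem exists_mul_le_of_mem_classB {ψ : ℝ → ℝ} (hB : ψ ∈ classB) :
    ∃ c : ℝ, 0 < c ∧ ∀ x y : ℝ, 1 ≤ x → x ≤ y → y ≤ 3 * x → c * ψ x ≤ ψ y := by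
  obtain ⟨hanti, hpos, K, hK, hdouble⟩ := hB
  refine ⟨(K * K)⁻¹, by positivity, fun x y hx hxy hyx => ?_⟩
  have hx_double := hdouble x hx
  have hx_quadruple := hdouble (2 * x) (by linarith)
  rw [div_le_iff₀ (hpos _ (by linarith))] at hx_double hx_quadruple
  have hy : ψ (2 * (2 * x)) ≤ ψ y :=
    hanti (hx.trans hxy) (show (1 : ℝ) ≤ 2 * (2 * x) by linarith) (by linarith)
  rw [inv_mul_le_iff₀ (by positivity)]
  calc ψ x ≤ K * ψ (2 * x) := hx_double
    _ ≤ K * (K * ψ (2 * (2 * x))) := by gcongr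
    _ ≤ K * (K * ψ y) := by gcongr
    _ = K * K * ψ y := by ring

theorem one_div_eq_one_sub_inv_toReal {p : ℝ≥0∞} {p' : ℝ}
    (hpp' : 1 / p + 1 / ENNReal.ofReal p' = 1) : 1 / p' = 1 - p.toReal⁻¹ := by
  have hp_top : 1 / p ≠ ∞ := ((le_self_add.trans_eq hpp').trans_lt ENNReal.one_lt_top).ne
  have hp'_top : 1 / ENNReal.ofReal p' ≠ ∞ :=
    ((le_add_self.trans_eq hpp').trans_lt ENNReal.one_lt_top).ne
  have hp' : 0 < p' := by
    by_contra h
    simp [ENNReal.ofReal_of_nonpos (not_lt.1 h)] at hp'_top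
  have h := congrArg ENNReal.toReal hpp'
  rw [ENNReal.toReal_add hp_top hp'_top, ENNReal.toReal_div, ENNReal.toReal_div,
    ENNReal.toReal_ofReal hp'.le, ENNReal.toReal_one, one_div p.toReal] at h
  linarith

theorem mainTheorem3_general {p : ℝ≥0∞} (hp : 1 < p) {p' : ℝ}
    (hpp' : 1 / p + 1 / ENNReal.ofReal p' = 1) {ψ : ℝ → ℝ} (hψ : ψ ∈ classB ∩ classTheta p') :
    ∃ K₃ K₄ : ℝ, 0 < K₃ ∧ 0 < K₄ ∧ ∀ (β : ℝ) (n : ℕ), 1 ≤ n →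
      ENNReal.ofReal (K₄ * (ψ n * (n : ℝ) ^ (1 / p'))) ≤ bestApprox n (psiClass ψ β 1) p ∧
      bestApprox n (psiClass ψ β 1) p ≤ fourierDeviation n (psiClass ψ β 1) p ∧
      fourierDeviation n (psiClass ψ β 1) p ≤
        ENNReal.ofReal (K₃ * (ψ n * (n : ℝ) ^ (1 / p'))) := by
  obtain ⟨α, K, hα, hα₁, h⟩ := exists_isAlmostDecreasing hψ.1 hψ.2
  rw [one_div_eq_one_sub_inv_toReal hpp'] at hα ⊢
  have hα₀ : 0 < α := by linarith [inv_toReal_le_one hp.le]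
  obtain ⟨C, hC, hupper⟩ := h.exists_fourierDeviation_le hα₁ hp (by linarith)
  obtain ⟨c, hc, hψ_ge⟩ := exists_mul_le_of_mem_classB hψ.1
  refine ⟨C, c / (8 * π), hC, by positivity, fun β n hn =>
    ⟨?_, bestApprox_le_fourierDeviation _ _ _, by simpa only [mul_assoc] using hupper β n hn⟩⟩
  have hψn : 0 < ψ n := h.pos n hn
  have hlower := le_bestApprox (h.isKernel_cosSeries hα₀ hα₁ β) hn (a := c * ψ n) (by positivity)
    (fun k hnk hkn => hψ_ge n k (by exact_mod_cast hn) (by exact_mod_cast hnk)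
      (by exact_mod_cast hkn)) hp.le
  rwa [mul_div_right_comm, mul_assoc] at hlower

theorem mainTheorem3 (p : ℝ≥0∞) (hp : 1 < p) (p' : ℝ) (hp' : 1 ≤ p')
    (hpp' : 1 / p + 1 / ENNReal.ofReal p' = 1)
    (ψ : ℝ → ℝ) (hcont : ContinuousOn ψ (Set.Ici 1)) (hψ : ψ ∈ classB ∩ classTheta p')
    (hΔ : (∀ k : ℕ, 1 ≤ k → 0 ≤ secondDiffInv ψ k) ∨
      (∀ k : ℕ, 1 ≤ k → secondDiffInv ψ k ≤ 0)) :
    ∃ K₃ K₄ : ℝ, 0 < K₃ ∧ 0 < K₄ ∧ ∀ (β : ℝ) (n : ℕ), 1 ≤ n →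
      ENNReal.ofReal (K₄ * (ψ n * (n : ℝ) ^ (1 / p'))) ≤ bestApprox n (psiClass ψ β 1) p ∧
      bestApprox n (psiClass ψ β 1) p ≤ fourierDeviation n (psiClass ψ β 1) p ∧
      fourierDeviation n (psiClass ψ β 1) p ≤
        ENNReal.ofReal (K₃ * (ψ n * (n : ℝ) ^ (1 / p'))) :=
  mainTheorem3_general hp hpp' hψ
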